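/- Entropies are measured in bits: $S(\rho)=-\mathrm{Tr}(\rho\log_2\rho)$ (with $0\log_2 0=0$) is the von Neumann entropy and $H_2(x)=-x\log_2 x-(1-x)\log_2(1-x)$ is the binary entropy function. For a qubit state $\rho$ let $\rho^D$ be its diagonal part in the standard basis of $\mathbb{C}^2$, and let $C_r(\rho)=S(\rho^D)-S(\rho)$ be its relative entropy of coherence. For $a\in[0,\frac12]$ let $\mathcal{O}_a=\{U\,\mathrm{diag}(1-a,a)\,U^\dagger: U\in SU(2)\}$; "chosen from $\mathcal{O}_a$" means distributed as $U\,\mathrm{diag}(1-a,a)\,U^\dagger$ with $U$ Haar-distributed in $SU(2)$. Let $\mathcal{E}_{2,2}$ be the ensemble of qubit states obtained by tracing out the second qubit of a pure two-qubit state, uniformly (Haar) distributed on the unit sphere of $\mathbb{C}^2\otimes\mathbb{C}^2$. (i) For $r_1,r_2\in(0,1)$ the average entropy $\overline{S}_2(r_1,r_2)$ of $\frac{\rho_1+\rho_2}{2}$, where $\rho_1,\rho_2$ are chosen independently from $\mathcal{O}_{(1-r_1)/2}$ and $\mathcal{O}_{(1-r_2)/2}$, is $$\overline{S}_2(r_1,r_2)=\int_{r_-}^{r_+}H_2\Big(\frac{1-r}{2}\Big)\,p(r|r_1,r_2)\,dr,\qquad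 p(r|r_1,r_2)=\frac{2r}{r_1r_2}\ \text{ for } r\in[r_-,r_+],\quad r_-=\frac{|r_1-r_2|}{2},\ r_+=\frac{r_1+r_2}{2}.$$ Furthermore, for $\rho_1,\rho_2$ chosen independently from $\mathcal{E}_{2,2}$, with $\overline{S}_2(r_1,r_2)$ as above for all $r_1,r_2\in[0,1]$ and $p^{(2)}(r)=12r^2(r^3-3r+2)$, $$\overline{S}_2:=\mathbb{E}\Big[S\Big(\frac{\rho_1+\rho_2}{2}\Big)\Big]=\int_0^1\!\!\int_0^1\overline{S}_2(r_1,r_2)\,3r_1^2\,3r_2^2\,dr_1\,dr_2=\int_0^1H_2\Big(\frac{1-r}{2}\Big)p^{(2)}(r)\,dr=\frac{221}{140\ln 2}-\frac{53}{35}\simeq 0.763111 .$$ (ii) For $a,b\in(0,\frac12)$ the average entropy $\overline{S}^D_2(a,b)$ of the diagonal part of $\frac{\rho_1+\rho_2}{2}$, where $\rho_1,\rho_2$ are chosen independently from $\mathcal{O}_a$ and $\mathcal{O}_b$, is $$\overline{S}^D_2(a,b)=\int_{t_0}^{1-t_0}H_2(x)\,q(x|a,b)\,dx,\qquad q(x|a,b)=\frac{1}{(\frac12-a)(\frac12-b)}\begin{cases}x-t_0,&x\in[t_0,t_1],\\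 t_1-t_0,&x\in[t_1,1-t_1],\\ 1-t_0-x,&x\in[1-t_1,1-t_0],\end{cases}$$ where $t_0=\frac{a+b}{2}$ and $t_1=\frac{1-|a-b|}{2}$. Furthermore, for $\rho_1,\rho_2$ chosen independently from $\mathcal{E}_{2,2}$, $$\overline{S}^D_2:=\mathbb{E}\Big[S\Big(\frac{\rho_1^D+\rho_2^D}{2}\Big)\Big]=\int_0^1\!\!\int_0^1\overline{S}^D_2\Big(\frac{1-r_1}{2},\frac{1-r_2}{2}\Big)3r_1^2\,3r_2^2\,dr_1\,dr_2\simeq 0.92414 .$$ Therefore the average relative entropy of coherence of the mixture is $\overline{C}^{(2)}_r:=\mathbb{E}\big[C_r\big(\frac{\rho_1+\rho_2}{2}\big)\big]=\overline{S}^D_2-\overline{S}_2\simeq 0.16103$. Here $\simeq$ means equality up to half a unit in the last decimal place displayed: errors at most $5\cdot10^{-7}$, $5\cdot10^{-6}$ and $5\cdot10^{-6}$, respectively. -/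

import Mathlib

open MeasureTheory Matrix

noncomputable section

namespace QubitMixture

/-! ### Borel structure on matrices, and the compact group `SU(d)` -/

instance instMeasurableSpaceMatrix {m n : Type*} : MeasurableSpace (Matrix m n ℂ) :=
  inferInstanceAs (MeasurableSpace (m → n → ℂ))

instance instBorelSpaceMatrix {m n : Type*} [Countable m] [Countable n] :
    BorelSpace (Matrix m n ℂ) :=
  inferInstanceAs (BorelSpace (m → n → ℂ))

instance instSecondCountableMatrix {m n : Type*} [Countable m] [Countable n] :
    SecondCountableTopology (Matrix m n ℂ) :=
  inferInstanceAs (SecondCountableTopology (m → n → ℂ))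

/-- The special unitary group of `d × d` complex matrices. -/
abbrev SU (d : ℕ) := Matrix.specialUnitaryGroup (Fin d) ℂ

instance instIsTopologicalGroupSU (d : ℕ) : IsTopologicalGroup (SU d) where
  continuous_mul := continuous_mul
  continuous_inv := by
    refine Continuous.subtype_mk (f := fun U : SU d => star (U : Matrix (Fin d) (Fin d) ℂ)) ?_ _
    exact continuous_star.comp continuous_subtype_val

instance instCompactSpaceSU (d : ℕ) : CompactSpace (SU d) := by
  have hc : IsCompact (Set.pi Set.univ fun _ : Fin d => Set.pi Set.univ fun _ : Fin d =>
      Metric.closedBall (0 : ℂ) 1) :=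
    isCompact_univ_pi fun _ => isCompact_univ_pi fun _ => isCompact_closedBall _ _
  have hcl : IsClosed {A : Matrix (Fin d) (Fin d) ℂ | A * star A = 1 ∧ A.det = 1} := by
    refine IsClosed.inter (isClosed_eq ?_ continuous_const) (isClosed_eq ?_ continuous_const)
    · exact continuous_id.mul continuous_star
    · exact Continuous.matrix_det continuous_id
  have hset : ((Matrix.specialUnitaryGroup (Fin d) ℂ : Submonoid _) :
      Set (Matrix (Fin d) (Fin d) ℂ)) = {A | A * star A = 1 ∧ A.det = 1} := by
    ext A
    simp only [SetLike.mem_coe, Matrix.mem_specialUnitaryGroup_iff, Matrix.mem_unitaryGroup_iff,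
      Set.mem_ofPred_eq]
  have hK : IsCompact ((Matrix.specialUnitaryGroup (Fin d) ℂ : Submonoid _) :
      Set (Matrix (Fin d) (Fin d) ℂ)) := by
    refine IsCompact.of_isClosed_subset (t := _) hc (hset ▸ hcl) ?_
    intro A hA i _ j _
    simpa using entry_norm_bound_of_unitary
      (Matrix.mem_specialUnitaryGroup_iff.1 hA).1 i j
  exact isCompact_iff_compactSpace.1 hK

/-- The normalized Haar measure of `SU(d)`. -/
def haarSU (d : ℕ) : Measure (SU d) := Measure.haarMeasure ⊤

/-! ### Random density matrices -/

/-- The uniform probability measure on the orbit `{U diag(l) U† : U ∈ SU(d)}`: the law of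
`U diag(l) U†` for a Haar-distributed `U`. -/
def orbitMeasure {d : ℕ} (l : Fin d → ℝ) : Measure (Matrix (Fin d) (Fin d) ℂ) :=
  (haarSU d).map fun U : SU d =>
    (U : Matrix (Fin d) (Fin d) ℂ) * Matrix.diagonal (fun i => (l i : ℂ)) *
      (U : Matrix (Fin d) (Fin d) ℂ)ᴴ

/-- The uniform probability measure on the qubit orbit `𝒪_a`, of spectrum `(1 - a, a)`. -/
def qubitOrbit (a : ℝ) : Measure (Matrix (Fin 2) (Fin 2) ℂ) := orbitMeasure ![1 - a, a]

/-- The uniform (unitarily invariant) probability measure on the unit sphere of `ℂ^d ⊗ ℂ^k`,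
that is, the law of a Haar-distributed pure state vector. -/
def haarPureState (d k : ℕ) :
    Measure (Metric.sphere (0 : EuclideanSpace ℂ (Fin d × Fin k)) 1) :=
  ((volume : Measure (EuclideanSpace ℂ (Fin d × Fin k))).toSphere Set.univ)⁻¹ •
    (volume : Measure (EuclideanSpace ℂ (Fin d × Fin k))).toSphere

/-- The rank-one operator `|ψ⟩⟨ψ|`. -/
def ketBra {ι : Type*} (ψ : EuclideanSpace ℂ ι) : Matrix ι ι ℂ :=
  Matrix.of fun i j => ψ i * star (ψ j)

/-- The partial trace over the second (`k`-dimensional) tensor factor. -/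
def partialTrace {d k : ℕ} (M : Matrix (Fin d × Fin k) (Fin d × Fin k) ℂ) :
    Matrix (Fin d) (Fin d) ℂ :=
  Matrix.of fun i j => ∑ l, M (i, l) (j, l)

/-- The ensemble `ℰ_{d,k}`: the law of the partial trace over the `k`-dimensional subsystem of a
Haar-distributed pure state of `ℂ^d ⊗ ℂ^k`. -/
def ensemble (d k : ℕ) : Measure (Matrix (Fin d) (Fin d) ℂ) :=
  (haarPureState d k).map fun ψ => partialTrace (ketBra ψ.1)

/-! ### Entropies and coherence -/

/-- The von Neumann entropy `S(ρ) = -Tr(ρ log₂ ρ)`, in bits, with `0 log₂ 0 = 0`. -/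
def vonNeumannEntropy {d : ℕ} (ρ : Matrix (Fin d) (Fin d) ℂ) : ℝ :=
  -(ρ * cfc (Real.logb 2) ρ).trace.re

/-- The binary entropy function `H₂(x) = -x log₂ x - (1 - x) log₂ (1 - x)`. -/
def H₂ (x : ℝ) : ℝ := -x * Real.logb 2 x - (1 - x) * Real.logb 2 (1 - x)

/-- The diagonal part `ρ^D` of `ρ` in the standard basis. -/
def diagPart {d : ℕ} (ρ : Matrix (Fin d) (Fin d) ℂ) : Matrix (Fin d) (Fin d) ℂ :=
  Matrix.diagonal fun i => ρ i i

/-- The relative entropy of coherence `C_r(ρ) = S(ρ^D) - S(ρ)`. -/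
def relEntropyCoherence {d : ℕ} (ρ : Matrix (Fin d) (Fin d) ℂ) : ℝ :=
  vonNeumannEntropy (diagPart ρ) - vonNeumannEntropy ρ

/-- `E[S((ρ₁ + ρ₂)/2)]` for independent `ρ₁ ∼ μ`, `ρ₂ ∼ ν`. -/
def avgEntropy {d : ℕ} (μ ν : Measure (Matrix (Fin d) (Fin d) ℂ)) : ℝ :=
  ∫ ρ, vonNeumannEntropy ((1 / 2 : ℂ) • (ρ.1 + ρ.2)) ∂(μ.prod ν)

/-- `E[S((ρ₁^D + ρ₂^D)/2)]` for independent `ρ₁ ∼ μ`, `ρ₂ ∼ ν`. -/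
def avgDiagEntropy {d : ℕ} (μ ν : Measure (Matrix (Fin d) (Fin d) ℂ)) : ℝ :=
  ∫ ρ, vonNeumannEntropy ((1 / 2 : ℂ) • (diagPart ρ.1 + diagPart ρ.2)) ∂(μ.prod ν)

/-- `E[C_r((ρ₁ + ρ₂)/2)]` for independent `ρ₁ ∼ μ`, `ρ₂ ∼ ν`. -/
def avgCoherence {d : ℕ} (μ ν : Measure (Matrix (Fin d) (Fin d) ℂ)) : ℝ :=
  ∫ ρ, relEntropyCoherence ((1 / 2 : ℂ) • (ρ.1 + ρ.2)) ∂(μ.prod ν)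

/-- `S̄₂(r₁, r₂)`: the average entropy of the equiprobable mixture of two random qubit states
chosen from the orbits of spectra `((1 ± r₁)/2)` and `((1 ± r₂)/2)`. -/
def avgEntropyOrbits (r₁ r₂ : ℝ) : ℝ :=
  avgEntropy (qubitOrbit ((1 - r₁) / 2)) (qubitOrbit ((1 - r₂) / 2))

/-- `S̄₂^D(a, b)`: the average entropy of the diagonal part of the equiprobable mixture of two
random qubit states chosen from the orbits `𝒪_a` and `𝒪_b`. -/
def avgDiagEntropyOrbits (a b : ℝ) : ℝ := avgDiagEntropy (qubitOrbit a) (qubitOrbit b)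

/-! ### The explicit densities -/

/-- `p(r | r₁, r₂)`: conditional density of the Bloch length of the equiprobable mixture. -/
def p (r r₁ r₂ : ℝ) : ℝ :=
  if |r₁ - r₂| / 2 ≤ r ∧ r ≤ (r₁ + r₂) / 2 then 2 * r / (r₁ * r₂) else 0

/-- `p⁽²⁾(r)`: density on `[0, 1]` of the Bloch length of the equiprobable mixture of two
independent states from `ℰ_{2,2}`. -/
def p2 (r : ℝ) : ℝ := 12 * r ^ 2 * (r ^ 3 - 3 * r + 2)

/-- `t₀ = (a + b)/2`. -/
def t₀ (a b : ℝ) : ℝ := (a + b) / 2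

/-- `t₁ = (1 - |a - b|)/2`. -/
def t₁ (a b : ℝ) : ℝ := (1 - |a - b|) / 2

/-- `q(x | a, b)`: density of a diagonal entry of the equiprobable mixture. -/
def q (x a b : ℝ) : ℝ :=
  1 / ((1 / 2 - a) * (1 / 2 - b)) *
    (if x < t₀ a b then 0
     else if x ≤ t₁ a b then x - t₀ a b
     else if x ≤ 1 - t₁ a b then t₁ a b - t₀ a b
     else if x ≤ 1 - t₀ a b then -x + (1 - t₀ a b)
     else 0)

end QubitMixture

end

noncomputable section

namespace QubitMixture

/-! ### The uniform measure on a sphere -/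

/-! A Hermitian qubit matrix of trace one has eigenvalues `(1 ± R)/2`, where `R` is its Bloch
length, so its entropy is `H₂ ((1 - R)/2)`; the entropy of its diagonal part is `H₂` of a diagonal
entry. Everything thus reduces to the laws of these two real variables.

Sphere moments come from Gaussian integrals: in polar coordinates a homogeneous function has a
Gaussian integral equal to its sphere average times a radial factor. Under the Gaussian weight the
squared moduli of the amplitudes are independent exponential variables, which gives the moments of
`|ψ₀₀|²` and of sums of two squared moduli. Averaging `|(Uψ)₀₀|^{2k}` over `U` and `ψ` in both
orders yields the moments of `|U₀₀|²`. Weierstrass approximation (`integral_comp_eq_of_moments`)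
turns moments into laws: `|U₀₀|²` is uniform on `[0, 1]`, and a diagonal entry of a state of
`ℰ_{2,2}` has density `6x(1-x)`.

The central device is Archimedes' theorem: conjugating by a Haar unitary makes the third Bloch
coordinate `Z` uniform on `[-R, R]`. In a unitarily invariant ensemble this gives `E[R^{2k}] =
(2k+1) E[Z^{2k}]`, so the law of `Z` determines that of `R`. For `ℰ_{2,2}` it gives the density
`3r²`, hence the double integrals over orbits. For the mixture, `Z` is a sum of two independent beta
variables minus one; its density is a polynomial self-convolution on `[0, 1]`, extended evenly, and
the resulting density of `R` is `p2`.

For fixed spectra, the law of cosines gives `R²` as an affine function of a uniform variable, and a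
change of variable produces `p`. The diagonal entry is affine in two independent uniform variables,
which produces the trapezoid `q`. The closed forms follow from explicit antiderivatives, and the
decimals from bounds on `log 2`. -/

theorem integral_normalize_mul_norm {E : Type*} [NormedAddCommGroup E] [NormedSpace ℝ E]
    [MeasurableSpace E] [BorelSpace E] [FiniteDimensional ℝ E] [Nontrivial E]
    (μ : Measure E) [μ.IsAddHaarMeasure] (h : E → ℝ) (g : ℝ → ℝ) :
    ∫ x, h (‖x‖⁻¹ • x) * g ‖x‖ ∂μ =
      (μ.toSphere.real Set.univ)⁻¹ * (∫ s, h s ∂μ.toSphere) * ∫ x, g ‖x‖ ∂μ := by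
  have key : ∀ h : E → ℝ, ∫ x, h (‖x‖⁻¹ • x) * g ‖x‖ ∂μ =
      (∫ s, h s ∂μ.toSphere) *
        ∫ y, g y ∂Measure.volumeIoiPow (Module.finrank ℝ E - 1) := by
    intro h
    calc ∫ x, h (‖x‖⁻¹ • x) * g ‖x‖ ∂μ
        = ∫ x : ({(0)}ᶜ : Set E), h (‖x.1‖⁻¹ • x.1) * g ‖x.1‖ ∂(μ.comap (↑)) := by
          rw [integral_subtype_comap (measurableSet_singleton _).compl
            fun x ↦ h (‖x‖⁻¹ • x) * g ‖x‖, restrict_compl_singleton]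
      _ = ∫ x, h x.1 * g x.2 ∂μ.toSphere.prod
            (.volumeIoiPow (Module.finrank ℝ E - 1)) := by
          simpa using μ.measurePreserving_homeomorphUnitSphereProd.integral_comp
            (Homeomorph.measurableEmbedding _)
            (fun z : Metric.sphere (0 : E) 1 × Set.Ioi (0 : ℝ) => h z.1 * g z.2)
      _ = _ := integral_prod_mul (fun s : Metric.sphere (0 : E) 1 => h s)
            (fun y : Set.Ioi (0 : ℝ) => g y)
  -- The case of the constant function 1 expresses the integral against `volumeIoiPow` through `∫ g
  -- ‖x‖`, so the radial measure can be eliminated.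
  have h1 := key fun _ => 1
  simp only [one_mul, integral_const, smul_eq_mul, mul_one] at h1
  have hpos : μ.toSphere.real Set.univ ≠ 0 := by
    rw [measureReal_def, ENNReal.toReal_ne_zero]
    exact ⟨Measure.measure_univ_ne_zero.2 (Measure.toSphere_ne_zero μ), measure_ne_top _ _⟩
  rw [key h, h1]
  field_simp

/-- The state space of two qubits. -/
abbrev TwoQubit := EuclideanSpace ℂ (Fin 2 × Fin 2)

instance instNontrivialTwoQubit : Nontrivial TwoQubit :=
  ⟨⟨0, EuclideanSpace.single (0, 0) 1, fun h => by
    have := congrArg (fun v : TwoQubit => v (0, 0)) h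
    simp at this⟩⟩

instance instIsProbabilityMeasureHaarPureState : IsProbabilityMeasure (haarPureState 2 2) :=
  ⟨by
    rw [haarPureState, Measure.smul_apply, smul_eq_mul]
    exact ENNReal.inv_mul_cancel
      (Measure.measure_univ_ne_zero.2 (Measure.toSphere_ne_zero _)) (measure_ne_top _ _)⟩

theorem integral_normalize_mul_norm_twoQubit (h : TwoQubit → ℝ) (g : ℝ → ℝ) :
    ∫ x, h (‖x‖⁻¹ • x) * g ‖x‖ = (∫ s, h s ∂haarPureState 2 2) * ∫ x : TwoQubit, g ‖x‖ := by
  rw [integral_normalize_mul_norm, haarPureState, integral_smul_measure, ENNReal.toReal_inv,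
    smul_eq_mul, measureReal_def]

theorem finrank_twoQubit : Module.finrank ℝ TwoQubit = 8 := by
  rw [← Module.finrank_mul_finrank ℝ ℂ TwoQubit]
  simp

/-- The real dimension is 8, so the radial weight is `y ^ 7` and the radial integral is `Γ(k + 4)/2
= (k + 3)!/2`; the 6 is the value `3!` at `k = 0`. -/
theorem integral_norm_pow_mul_exp_twoQubit (k : ℕ) :
    ∫ x : TwoQubit, ‖x‖ ^ (2 * k) * Real.exp (-‖x‖ ^ 2) =
      (k + 3).factorial / 6 * ∫ x : TwoQubit, Real.exp (-‖x‖ ^ 2) := by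
  have hg : ∀ k : ℕ, ∫ y in Set.Ioi (0 : ℝ), y ^ 7 * (y ^ (2 * k) * Real.exp (-y ^ 2)) =
      (k + 3).factorial / 2 := by
    intro k
    have := integral_rpow_mul_exp_neg_rpow (p := 2) (q := (2 * k + 7 : ℕ)) (by norm_num)
      (by have : (0 : ℝ) ≤ ((2 * k + 7 : ℕ) : ℝ) := Nat.cast_nonneg _
          linarith)
    have h2 : (((2 * k + 7 : ℕ) : ℝ) + 1) / 2 = ((k + 3 : ℕ) : ℝ) + 1 := by push_cast; ring
    rw [h2, Real.Gamma_nat_eq_factorial] at this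
    rw [div_eq_inv_mul, ← one_div, ← this]
    refine setIntegral_congr_fun measurableSet_Ioi fun y _ => ?_
    simp only [Real.rpow_natCast, Real.rpow_two]
    ring
  have h0 := hg 0
  have hk := hg k
  simp only [mul_zero, pow_zero, one_mul] at h0
  rw [integral_fun_norm_addHaar volume (fun y => y ^ (2 * k) * Real.exp (-y ^ 2)),
    integral_fun_norm_addHaar volume (fun y => Real.exp (-y ^ 2)), finrank_twoQubit]
  simp only [smul_eq_mul, nsmul_eq_mul, Nat.reduceSub]
  rw [hk, h0]
  simp only [Nat.factorial]
  push_cast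
  ring

theorem integral_exp_twoQubit_pos : 0 < ∫ x : TwoQubit, Real.exp (-‖x‖ ^ 2) := by
  have hi : Integrable fun x : TwoQubit => Real.exp (-‖x‖ ^ 2) := by
    rw [integrable_fun_norm_addHaar volume (f := fun y => Real.exp (-y ^ 2)), finrank_twoQubit]
    have := integrableOn_rpow_mul_exp_neg_rpow (p := 2) (s := 7) (by norm_num) (by norm_num)
    refine this.congr_fun (fun y _ => ?_) measurableSet_Ioi
    simp only [Nat.reduceSub, smul_eq_mul, Real.rpow_two]
    congr 1
    exact_mod_cast Real.rpow_natCast y 7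
  exact integral_exp_pos hi

/-- Homogeneous functions of degree `2k`: sphere averages from Gaussian integrals. -/
theorem integral_haarPureState_of_homogeneous (k : ℕ) (P : TwoQubit → ℝ)
    (hP : ∀ (c : ℝ) x, P (c • x) = c ^ (2 * k) * P x) :
    (∫ s, P s ∂haarPureState 2 2) * ((k + 3).factorial / 6) *
        ∫ x : TwoQubit, Real.exp (-‖x‖ ^ 2) =
      ∫ x : TwoQubit, P x * Real.exp (-‖x‖ ^ 2) := by
  rw [mul_assoc, ← integral_norm_pow_mul_exp_twoQubit,
    ← integral_normalize_mul_norm_twoQubit P (fun y => y ^ (2 * k) * Real.exp (-y ^ 2))]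
  refine integral_congr_ae ?_
  filter_upwards [Measure.ae_ne volume (0 : TwoQubit)] with x hx
  have : ‖x‖ ≠ 0 := norm_ne_zero_iff.2 hx
  simp only [hP, inv_pow]
  field_simp

/-- A linear isometry preserves both Lebesgue measure and the Gaussian weight; the common positive
radial factor then cancels. -/
theorem integral_haarPureState_isometry (e : TwoQubit ≃ₗᵢ[ℝ] TwoQubit) (h : TwoQubit → ℝ) :
    ∫ s, h (e s) ∂haarPureState 2 2 = ∫ s, h s ∂haarPureState 2 2 := by
  have h1 := integral_normalize_mul_norm_twoQubit (fun x => h (e x)) (fun y => Real.exp (-y ^ 2))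
  have h2 := integral_normalize_mul_norm_twoQubit h (fun y => Real.exp (-y ^ 2))
  have h3 := e.measurePreserving.integral_comp e.toHomeomorph.measurableEmbedding
    (fun x => h (‖x‖⁻¹ • x) * Real.exp (-‖x‖ ^ 2))
  simp only [LinearIsometryEquiv.norm_map, ← map_smul] at h3
  rw [h1, h2] at h3
  exact mul_right_cancel₀ integral_exp_twoQubit_pos.ne' h3

/-! ### Gaussian moments -/

theorem integral_normSq_pow_mul_exp (k : ℕ) :
    ∫ z : ℂ, (‖z‖ ^ 2) ^ k * Real.exp (-‖z‖ ^ 2) = k.factorial * Real.pi := by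
  have := Complex.integral_rpow_mul_exp_neg_rpow (p := 2) (q := (2 * k : ℕ)) (by norm_num)
    (by have : (0 : ℝ) ≤ ((2 * k : ℕ) : ℝ) := Nat.cast_nonneg _
        linarith)
  have h2 : (((2 * k : ℕ) : ℝ) + 2) / 2 = (k : ℝ) + 1 := by push_cast; ring
  rw [h2, Real.Gamma_nat_eq_factorial] at this
  rw [show (k.factorial : ℝ) * Real.pi = 2 * Real.pi / 2 * k.factorial by ring, ← this]
  simp only [Real.rpow_natCast, Real.rpow_two, pow_mul]

theorem integrable_normSq_pow_mul_exp (k : ℕ) :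
    Integrable fun z : ℂ => (‖z‖ ^ 2) ^ k * Real.exp (-‖z‖ ^ 2) := by
  refine Integrable.of_integral_ne_zero ?_
  rw [integral_normSq_pow_mul_exp]
  positivity

/-- Gaussian integrals of monomials in the squared moduli of the amplitudes. -/
theorem exists_integral_monomial_mul_exp : ∃ c : ℝ, c ≠ 0 ∧ ∀ m : Fin 2 × Fin 2 → ℕ,
    Integrable (fun x : TwoQubit => (∏ i, (‖x i‖ ^ 2) ^ m i) * Real.exp (-‖x‖ ^ 2)) ∧
    ∫ x : TwoQubit, (∏ i, (‖x i‖ ^ 2) ^ m i) * Real.exp (-‖x‖ ^ 2) =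
      c * ∏ i, ((m i).factorial : ℝ) := by
  let e : TwoQubit ≃L[ℝ] (Fin 2 × Fin 2 → ℂ) :=
    (PiLp.continuousLinearEquiv 2 ℝ (fun _ : Fin 2 × Fin 2 => ℂ))
  have : ((volume : Measure TwoQubit).map e).IsAddHaarMeasure :=
    ContinuousLinearEquiv.isAddHaarMeasure_map e volume
  -- Uniqueness of Haar measure gives proportionality to the product measure. The constant need not
  -- be computed, since only ratios of Gaussian integrals are used.
  obtain ⟨c, hc, hcc⟩ : ∃ c : NNReal, c ≠ 0 ∧ (volume : Measure TwoQubit).map e =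
      c • (volume : Measure (Fin 2 × Fin 2 → ℂ)) :=
    ⟨_, (Measure.addHaarScalarFactor_pos_of_isAddHaarMeasure _ _).ne',
      Measure.isAddLeftInvariant_eq_smul _ _⟩
  have he : MeasurableEmbedding e := e.toHomeomorph.measurableEmbedding
  obtain ⟨G, hG⟩ : ∃ G : (Fin 2 × Fin 2 → ℕ) → (Fin 2 × Fin 2 → ℂ) → ℝ,
      G = fun m y => ∏ i, ((‖y i‖ ^ 2) ^ m i * Real.exp (-‖y i‖ ^ 2)) := ⟨_, rfl⟩
  have hfun : ∀ (m : Fin 2 × Fin 2 → ℕ) (x : TwoQubit),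
      (∏ i, (‖x i‖ ^ 2) ^ m i) * Real.exp (-‖x‖ ^ 2) =
      G m (e x) := by
    intro m x
    simp only [hG, Finset.prod_mul_distrib, ← Real.exp_sum, EuclideanSpace.norm_sq_eq,
      Finset.sum_neg_distrib]
    rfl
  refine ⟨c * Real.pi ^ 4, by positivity, fun m => ⟨?_, ?_⟩⟩
  · simp only [hfun]
    change Integrable (G m ∘ e)
    rw [← he.integrable_map_iff, hcc]
    refine Integrable.smul_measure ?_ (by simp)
    rw [hG]
    exact Integrable.fintype_prod (f := fun i (z : ℂ) => (‖z‖ ^ 2) ^ m i * Real.exp (-‖z‖ ^ 2))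
      fun i => integrable_normSq_pow_mul_exp (m i)
  · simp only [hfun]
    rw [← he.integral_map, hcc, integral_smul_nnreal_measure, hG, volume_pi,
      integral_fintype_prod_eq_prod (f := fun i (z : ℂ) => (‖z‖ ^ 2) ^ m i * Real.exp (-‖z‖ ^ 2))]
    simp only [integral_normSq_pow_mul_exp, Finset.prod_mul_distrib, Finset.prod_const,
      Finset.card_univ, Fintype.card_prod, Fintype.card_fin, NNReal.smul_def, smul_eq_mul]
    ring

/-- An exponential variable has `k`-th moment `k!`; dividing by the radial factor `(k + 3)!/3!`
gives the value. -/
theorem integral_normSq_pow_haarPureState (k : ℕ) :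
    ∫ s, (‖s.1 (0, 0)‖ ^ 2) ^ k ∂haarPureState 2 2 = 6 / ((k + 1) * (k + 2) * (k + 3)) := by
  obtain ⟨c, hc, hm⟩ := exists_integral_monomial_mul_exp
  have h1 := integral_haarPureState_of_homogeneous k (fun x => (‖x (0, 0)‖ ^ 2) ^ k) (by
    intro a x
    simp [mul_pow, pow_mul])
  have h0 := (hm 0).2
  have h2 := (hm (Pi.single (0, 0) k)).2
  simp [Fintype.prod_prod_type, Pi.single_apply] at h0 h2
  rw [h0, h2] at h1
  have hk : (k.factorial : ℝ) ≠ 0 := by positivity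
  have : ((k + 3).factorial : ℝ) = (k + 3) * ((k + 2) * ((k + 1) * k.factorial)) := by
    simp only [Nat.factorial]; push_cast; ring
  rw [this] at h1
  field_simp at h1 ⊢
  linarith

/-- The sum of two independent exponential variables has `k`-th moment `(k + 1)!`: in the binomial
expansion each of the `k + 1` terms contributes `k.choose a * a! * (k - a)! = k!`. -/
theorem integral_normSq_add_pow_haarPureState (i j : Fin 2 × Fin 2) (hij : i ≠ j) (k : ℕ) :
    ∫ s, (‖s.1 i‖ ^ 2 + ‖s.1 j‖ ^ 2) ^ k ∂haarPureState 2 2 =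
      6 / ((k + 2) * (k + 3)) := by
  obtain ⟨c, hc, hm⟩ := exists_integral_monomial_mul_exp
  have h1 := integral_haarPureState_of_homogeneous k
    (fun x => (‖x i‖ ^ 2 + ‖x j‖ ^ 2) ^ k) (by
    intro a x
    simp [mul_pow, pow_mul, ← mul_add])
  have h0 := (hm 0).2
  simp at h0
  have hmono : ∀ (a b : ℕ) (f : Fin 2 × Fin 2 → ℕ → ℝ), (∀ i, f i 0 = 1) →
      ∏ l, f l ((Pi.single i a + Pi.single j b : Fin 2 × Fin 2 → ℕ) l) = f i a * f j b := by
    intro a b f hf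
    rw [← Finset.prod_subset (Finset.subset_univ {i, j}), Finset.prod_pair hij]
    · simp [hij, hij.symm]
    · intro l _ hl
      simp only [Finset.mem_insert, Finset.mem_singleton, not_or] at hl
      simp [hl.1, hl.2, hf]
  have h2 : ∫ x : TwoQubit, (‖x i‖ ^ 2 + ‖x j‖ ^ 2) ^ k * Real.exp (-‖x‖ ^ 2) =
      c * (k + 1).factorial := by
    have hexp : ∀ x : TwoQubit, (‖x i‖ ^ 2 + ‖x j‖ ^ 2) ^ k * Real.exp (-‖x‖ ^ 2) =
        ∑ a ∈ Finset.range (k + 1), (k.choose a : ℝ) *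
          ((∏ l, (‖x l‖ ^ 2) ^ ((Pi.single i a + Pi.single j (k - a) : Fin 2 × Fin 2 → ℕ) l)) *
            Real.exp (-‖x‖ ^ 2)) := by
      intro x
      rw [add_pow, Finset.sum_mul]
      refine Finset.sum_congr rfl fun a _ => ?_
      rw [hmono _ _ (fun l n => (‖x l‖ ^ 2) ^ n) (by simp)]
      ring
    simp only [hexp]
    rw [integral_finsetSum _ fun a _ => (hm _).1.const_mul _]
    simp only [integral_const_mul, (hm _).2]
    have : ∀ a ∈ Finset.range (k + 1), (k.choose a : ℝ) * (c * ∏ l,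
        (((Pi.single i a + Pi.single j (k - a) : Fin 2 × Fin 2 → ℕ) l).factorial : ℝ)) =
        c * k.factorial := by
      intro a ha
      rw [hmono _ _ (fun _ n => (n.factorial : ℝ)) (by simp)]
      have := Nat.choose_mul_factorial_mul_factorial (Nat.lt_succ_iff.1 (Finset.mem_range.1 ha))
      rw [← this]
      push_cast
      ring
    rw [Finset.sum_congr rfl this]
    simp [Nat.factorial]
    ring
  rw [h0, h2] at h1
  have hk : (k.factorial : ℝ) ≠ 0 := by positivity
  have : ((k + 3).factorial : ℝ) = (k + 3) * ((k + 2) * ((k + 1) * k.factorial)) := by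
    simp only [Nat.factorial]; push_cast; ring
  have h' : ((k + 1).factorial : ℝ) = (k + 1) * k.factorial := by
    simp only [Nat.factorial]; push_cast; ring
  rw [this, h'] at h1
  field_simp at h1 ⊢
  linarith

/-! ### Laws on `[0, 1]` are determined by their moments -/

theorem integrable_of_continuous_compactSpace {X : Type*} [TopologicalSpace X] [CompactSpace X]
    [MeasurableSpace X] [OpensMeasurableSpace X] {μ : Measure X} [IsFiniteMeasure μ]
    {f : X → ℝ} (hf : Continuous f) : Integrable f μ :=
  hf.integrable_of_hasCompactSupport (HasCompactSupport.of_compactSpace f)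

/-- The identity extends linearly from powers to polynomials, then to continuous functions by
Weierstrass approximation on `[0, 1]`. The map `Y` allows a law to be described through a parameter:
below, the moments are those of a squared Bloch length while the density is in the length itself. -/
theorem integral_comp_eq_of_moments {Ω : Type*} [MeasurableSpace Ω] {μ : Measure Ω}
    [IsProbabilityMeasure μ] {X : Ω → ℝ} (hX : Measurable X) (hX01 : ∀ ω, X ω ∈ Set.Icc (0 : ℝ) 1)
    {Y w : ℝ → ℝ} (hY : Continuous Y) (hw : Continuous w)
    (hY01 : ∀ x ∈ Set.Icc (0 : ℝ) 1, Y x ∈ Set.Icc (0 : ℝ) 1)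
    (hmom : ∀ k : ℕ, ∫ ω, X ω ^ k ∂μ = ∫ x in (0 : ℝ)..1, Y x ^ k * w x)
    {φ : ℝ → ℝ} (hφ : Continuous φ) :
    ∫ ω, φ (X ω) ∂μ = ∫ x in (0 : ℝ)..1, φ (Y x) * w x := by
  obtain ⟨B, hB⟩ := isCompact_Icc.exists_bound_of_continuousOn (s := Set.Icc (0 : ℝ) 1)
    hw.continuousOn
  have hB0 : 0 ≤ B := (norm_nonneg _).trans (hB 0 (by simp))
  have hint : ∀ g : ℝ → ℝ, Continuous g → Integrable (fun ω => g (X ω)) μ := by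
    intro g hg
    obtain ⟨C, hC⟩ := isCompact_Icc.exists_bound_of_continuousOn (s := Set.Icc (0 : ℝ) 1)
      hg.continuousOn
    exact Integrable.of_bound (hg.measurable.comp hX).aestronglyMeasurable C
      (Filter.Eventually.of_forall fun ω => hC _ (hX01 ω))
  have hpoly : ∀ p : Polynomial ℝ,
      ∫ ω, p.eval (X ω) ∂μ = ∫ x in (0 : ℝ)..1, p.eval (Y x) * w x := by
    intro p
    induction p using Polynomial.induction_on' with
    | add p q hp hq =>
      simp only [Polynomial.eval_add, add_mul]
      rw [integral_add (hint _ p.continuous) (hint _ q.continuous), hp, hq,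
        intervalIntegral.integral_add]
      · exact ((p.continuous.comp hY).mul hw).intervalIntegrable _ _
      · exact ((q.continuous.comp hY).mul hw).intervalIntegrable _ _
    | monomial n a =>
      simp only [Polynomial.eval_monomial, mul_assoc, integral_const_mul,
        intervalIntegral.integral_const_mul, hmom]
  refine eq_of_forall_dist_le fun ε hε => ?_
  -- The two sides contribute errors of at most `ε/(1 + B)` and `B ε/(1 + B)`, with total `ε`.
  obtain ⟨p, hp⟩ := exists_polynomial_near_of_continuousOn 0 1 φ hφ.continuousOn (ε / (1 + B))
    (by positivity)
  have h1 : ‖∫ ω, (p.eval (X ω) - φ (X ω)) ∂μ‖ ≤ ε / (1 + B) := by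
    have := norm_integral_le_of_norm_le_const (μ := μ) (C := ε / (1 + B))
      (f := fun ω => p.eval (X ω) - φ (X ω))
      (Filter.Eventually.of_forall fun ω => (hp _ (hX01 ω)).le)
    simpa using this
  have h2 : ‖∫ x in (0 : ℝ)..1, (p.eval (Y x) - φ (Y x)) * w x‖ ≤ ε / (1 + B) * B := by
    have := intervalIntegral.norm_integral_le_of_norm_le_const (a := 0) (b := 1)
      (C := ε / (1 + B) * B) (f := fun x => (p.eval (Y x) - φ (Y x)) * w x) (fun x hx => by
        rw [Set.uIoc_of_le zero_le_one] at hx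
        have hx' : x ∈ Set.Icc (0 : ℝ) 1 := ⟨hx.1.le, hx.2⟩
        rw [norm_mul]
        exact mul_le_mul (hp _ (hY01 x hx')).le (hB x hx') (norm_nonneg _) (by positivity))
    simpa using this
  rw [integral_sub (hint _ p.continuous) (hint _ hφ), hpoly] at h1
  simp only [sub_mul] at h2
  have h3 : ∫ x in (0 : ℝ)..1, (p.eval (Y x) * w x - φ (Y x) * w x) =
      (∫ x in (0 : ℝ)..1, p.eval (Y x) * w x) - ∫ x in (0 : ℝ)..1, φ (Y x) * w x :=
    intervalIntegral.integral_sub (((p.continuous.comp hY).mul hw).intervalIntegrable _ _)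
      (((hφ.comp hY).mul hw).intervalIntegrable _ _)
  rw [h3] at h2
  rw [Real.norm_eq_abs, abs_le] at h1 h2
  rw [Real.dist_eq, abs_le]
  have hε' : ε / (1 + B) + ε / (1 + B) * B = ε := by field_simp
  constructor <;> linarith [h1.1, h1.2, h2.1, h2.2]

/-! ### Haar measure on `SU(2)` -/

instance instIsHaarMeasureHaarSU (d : ℕ) : (haarSU d).IsHaarMeasure :=
  inferInstanceAs (Measure.haarMeasure ⊤).IsHaarMeasure

instance instIsProbabilityMeasureHaarSU (d : ℕ) : IsProbabilityMeasure (haarSU d) :=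
  ⟨by
    have h := Measure.haarMeasure_self (K₀ := (⊤ : TopologicalSpace.PositiveCompacts (SU d)))
    rwa [TopologicalSpace.PositiveCompacts.coe_top] at h⟩

/-- Compact groups are unimodular: a right translate of Haar measure is a multiple of it, and the
total mass forces the factor to be 1. -/
instance instIsMulRightInvariantHaarSU (d : ℕ) : (haarSU d).IsMulRightInvariant where
  map_mul_right_eq_self g := by
    have h := Measure.isMulInvariant_eq_smul_of_compactSpace
      ((haarSU d).map fun x => x * g) (haarSU d)
    have hu := congrArg (fun m : Measure (SU d) => m Set.univ) h
    simp only [Measure.smul_apply, measure_univ] at hu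
    rw [Measure.map_apply (measurable_mul_const g) MeasurableSet.univ, Set.preimage_univ,
      measure_univ] at hu
    have hc : ((haarSU d).map fun x => x * g).haarScalarFactor (haarSU d) = 1 := by
      simpa [ENNReal.smul_def] using hu.symm
    rw [h, hc, one_smul]

theorem continuous_coe_SU (d : ℕ) : Continuous fun U : SU d => (U : Matrix (Fin d) (Fin d) ℂ) :=
  continuous_subtype_val

theorem continuous_SU_apply {d : ℕ} (i j : Fin d) :
    Continuous fun U : SU d => (U : Matrix (Fin d) (Fin d) ℂ) i j :=
  (continuous_coe_SU d).matrix_elem i j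

theorem SU_mul_conjTranspose {d : ℕ} (U : SU d) :
    (U : Matrix (Fin d) (Fin d) ℂ) * (U : Matrix (Fin d) (Fin d) ℂ)ᴴ = 1 :=
  Matrix.mem_unitaryGroup_iff.1 (Matrix.mem_specialUnitaryGroup_iff.1 U.2).1

theorem SU_conjTranspose_mul {d : ℕ} (U : SU d) :
    (U : Matrix (Fin d) (Fin d) ℂ)ᴴ * (U : Matrix (Fin d) (Fin d) ℂ) = 1 :=
  Matrix.mem_unitaryGroup_iff'.1 (Matrix.mem_specialUnitaryGroup_iff.1 U.2).1

theorem SU_det {d : ℕ} (U : SU d) : (U : Matrix (Fin d) (Fin d) ℂ).det = 1 :=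
  (Matrix.mem_specialUnitaryGroup_iff.1 U.2).2

theorem SU_norm_sq_row (U : SU 2) (i : Fin 2) :
    ‖(U : Matrix (Fin 2) (Fin 2) ℂ) i 0‖ ^ 2 + ‖(U : Matrix (Fin 2) (Fin 2) ℂ) i 1‖ ^ 2 = 1 := by
  have h := congrFun (congrFun (SU_mul_conjTranspose U) i) i
  simp only [Matrix.mul_apply, Fin.sum_univ_two, conjTranspose_apply, RCLike.star_def,
    Complex.mul_conj', one_apply_eq] at h
  exact_mod_cast h

/-- Any vector of `ℂ²` is a multiple of the first column of an element of `SU(2)`. -/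
theorem exists_SU_column (v w : ℂ) : ∃ (n : ℝ) (V : SU 2), n ^ 2 = ‖v‖ ^ 2 + ‖w‖ ^ 2 ∧
    v = n * (V : Matrix (Fin 2) (Fin 2) ℂ) 0 0 ∧ w = n * (V : Matrix (Fin 2) (Fin 2) ℂ) 1 0 := by
  set n : ℝ := √(‖v‖ ^ 2 + ‖w‖ ^ 2) with hn
  refine ⟨n, ?_⟩
  have hn2 : n ^ 2 = ‖v‖ ^ 2 + ‖w‖ ^ 2 := Real.sq_sqrt (by positivity)
  rcases eq_or_ne n 0 with h0 | h0
  · have : ‖v‖ ^ 2 + ‖w‖ ^ 2 = 0 := (Real.sqrt_eq_zero (by positivity)).1 h0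
    have hv : v = 0 := by
      have : ‖v‖ ^ 2 = 0 := by nlinarith [sq_nonneg ‖v‖, sq_nonneg ‖w‖]
      simpa using this
    have hw : w = 0 := by
      have : ‖w‖ ^ 2 = 0 := by nlinarith [sq_nonneg ‖v‖, sq_nonneg ‖w‖]
      simpa using this
    exact ⟨1, hn2, by simp [hv, h0], by simp [hw, h0]⟩
  · have hsq : v * star v + w * star w = (n : ℂ) * n := by
      rw [← Complex.ofReal_mul, ← pow_two, hn2]
      simp [Complex.mul_conj']
    have hnc : (n : ℂ) ≠ 0 := by exact_mod_cast h0
    have hmem : (!![v / n, -star w / n; w / n, star v / n] : Matrix (Fin 2) (Fin 2) ℂ) ∈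
        Matrix.specialUnitaryGroup (Fin 2) ℂ := by
      rw [Matrix.mem_specialUnitaryGroup_iff, Matrix.mem_unitaryGroup_iff]
      constructor
      · ext i j
        fin_cases i <;> fin_cases j <;>
          simp [Matrix.mul_apply, Fin.sum_univ_two, star_eq_conjTranspose] <;> field_simp <;>
          simp only [RCLike.star_def] at hsq <;>
          first | linear_combination hsq | ring
      · rw [Matrix.det_fin_two_of]
        field_simp
        linear_combination hsq
    exact ⟨⟨_, hmem⟩, hn2, by simp [mul_div_cancel₀ _ hnc], by simp [mul_div_cancel₀ _ hnc]⟩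

/-- The action of `U ⊗ 1` on pure states of two qubits. -/
def actLeft (U : SU 2) (ψ : TwoQubit) : TwoQubit :=
  WithLp.toLp 2 fun p => ∑ l, (U : Matrix (Fin 2) (Fin 2) ℂ) p.1 l * ψ (l, p.2)

theorem actLeft_apply (U : SU 2) (ψ : TwoQubit) (i j : Fin 2) :
    actLeft U ψ (i, j) = (U : Matrix (Fin 2) (Fin 2) ℂ) i 0 * ψ (0, j) +
      (U : Matrix (Fin 2) (Fin 2) ℂ) i 1 * ψ (1, j) := by
  simp [actLeft, Fin.sum_univ_two]

theorem actLeft_mul (U V : SU 2) (ψ : TwoQubit) : actLeft (U * V) ψ = actLeft U (actLeft V ψ) := by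
  ext ⟨i, j⟩
  simp only [actLeft_apply, Submonoid.coe_mul, Matrix.mul_apply, Fin.sum_univ_two]
  ring

theorem norm_actLeft (U : SU 2) (ψ : TwoQubit) : ‖actLeft U ψ‖ = ‖ψ‖ := by
  have h := SU_conjTranspose_mul U
  have h00 := congrFun (congrFun h 0) 0
  have h01 := congrFun (congrFun h 0) 1
  have h10 := congrFun (congrFun h 1) 0
  have h11 := congrFun (congrFun h 1) 1
  simp only [Matrix.mul_apply, Fin.sum_univ_two, conjTranspose_apply, RCLike.star_def,
    one_apply] at h00 h01 h10 h11
  simp at h00 h01 h10 h11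
  have hcol : ∀ j, ‖actLeft U ψ (0, j)‖ ^ 2 + ‖actLeft U ψ (1, j)‖ ^ 2 =
      ‖ψ (0, j)‖ ^ 2 + ‖ψ (1, j)‖ ^ 2 := by
    intro j
    have : ((‖actLeft U ψ (0, j)‖ ^ 2 + ‖actLeft U ψ (1, j)‖ ^ 2 : ℝ) : ℂ) =
      ((‖ψ (0, j)‖ ^ 2 + ‖ψ (1, j)‖ ^ 2 : ℝ) : ℂ) := by
      push_cast
      simp only [← Complex.mul_conj', actLeft_apply, map_add, map_mul]
      linear_combination ψ (0, j) * (starRingEnd ℂ) (ψ (0, j)) * h00 +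
        ψ (1, j) * (starRingEnd ℂ) (ψ (0, j)) * h01 + ψ (0, j) * (starRingEnd ℂ) (ψ (1, j)) * h10 +
        ψ (1, j) * (starRingEnd ℂ) (ψ (1, j)) * h11
    exact_mod_cast this
  have h2 : ‖actLeft U ψ‖ ^ 2 = ‖ψ‖ ^ 2 := by
    simp only [EuclideanSpace.norm_sq_eq, Fintype.sum_prod_type, Fin.sum_univ_two]
    linear_combination hcol 0 + hcol 1
  exact (sq_eq_sq₀ (norm_nonneg _) (norm_nonneg _)).1 h2

/-- `U ⊗ 1` as a linear isometry. -/
def actLeftIsometry (U : SU 2) : TwoQubit ≃ₗᵢ[ℝ] TwoQubit where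
  toFun := actLeft U
  invFun := actLeft U⁻¹
  map_add' ψ φ := by
    ext ⟨i, j⟩
    simp only [actLeft_apply, PiLp.add_apply]
    ring
  map_smul' c ψ := by
    ext ⟨i, j⟩
    simp only [actLeft_apply, PiLp.smul_apply, Complex.real_smul, RingHom.id_apply]
    ring
  left_inv ψ := by
    rw [← actLeft_mul, inv_mul_cancel]
    ext ⟨i, j⟩
    fin_cases i <;> simp [actLeft_apply]
  right_inv ψ := by
    rw [← actLeft_mul, mul_inv_cancel]
    ext ⟨i, j⟩
    fin_cases i <;> simp [actLeft_apply]
  norm_map' := norm_actLeft U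

theorem integral_haarPureState_actLeft (U : SU 2) (h : TwoQubit → ℝ) :
    ∫ s, h (actLeft U s) ∂haarPureState 2 2 = ∫ s, h s ∂haarPureState 2 2 :=
  integral_haarPureState_isometry (actLeftIsometry U) h

/-- The pure states of two qubits. -/
abbrev PureTwoQubit := Metric.sphere (0 : EuclideanSpace ℂ (Fin 2 × Fin 2)) 1

theorem continuous_pureTwoQubit_apply (i : Fin 2 × Fin 2) :
    Continuous fun s : PureTwoQubit => s.1 i :=
  (PiLp.continuous_apply 2 _ i).comp continuous_subtype_val

/-- Average `|((U ⊗ 1)ψ)₀₀|^{2k}` over `U` and `ψ`. Integrating over `ψ` first removes `U` by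
invariance. Integrating over `U` first, write the column `(ψ₀₀, ψ₁₀)` as `n` times the first column
of some `V`; right invariance then leaves `n^{2k}` times the desired moment. Comparing the two
sphere moments gives `1/(k + 1)`. -/
theorem integral_normSq_pow_haarSU (k : ℕ) :
    ∫ U, (‖(U : Matrix (Fin 2) (Fin 2) ℂ) 0 0‖ ^ 2) ^ k ∂haarSU 2 = 1 / (k + 1) := by
  have hswap : ∫ s, ∫ U, (‖actLeft U s.1 (0, 0)‖ ^ 2) ^ k ∂haarSU 2 ∂haarPureState 2 2 =
      ∫ U, ∫ s, (‖actLeft U s.1 (0, 0)‖ ^ 2) ^ k ∂haarPureState 2 2 ∂haarSU 2 := by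
    refine integral_integral_swap (integrable_of_continuous_compactSpace ?_)
    simp only [Function.uncurry_def, actLeft_apply]
    refine ((((Continuous.mul ?_ ?_).add (Continuous.mul ?_ ?_)).norm).pow 2).pow k
    · exact (continuous_SU_apply 0 0).comp continuous_snd
    · exact (continuous_pureTwoQubit_apply (0, 0)).comp continuous_fst
    · exact (continuous_SU_apply 0 1).comp continuous_snd
    · exact (continuous_pureTwoQubit_apply (1, 0)).comp continuous_fst
  have hR : ∀ U : SU 2, ∫ s, (‖actLeft U s.1 (0, 0)‖ ^ 2) ^ k ∂haarPureState 2 2 =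
      6 / ((k + 1) * (k + 2) * (k + 3)) := fun U => by
    rw [integral_haarPureState_actLeft U (fun ψ => (‖ψ (0, 0)‖ ^ 2) ^ k),
      integral_normSq_pow_haarPureState]
  have hL : ∀ s : PureTwoQubit, ∫ U, (‖actLeft U s.1 (0, 0)‖ ^ 2) ^ k ∂haarSU 2 =
      (‖s.1 (0, 0)‖ ^ 2 + ‖s.1 (1, 0)‖ ^ 2) ^ k *
        ∫ U, (‖(U : Matrix (Fin 2) (Fin 2) ℂ) 0 0‖ ^ 2) ^ k ∂haarSU 2 := by
    intro s
    obtain ⟨n, V, hn, h0, h1⟩ := exists_SU_column (s.1 (0, 0)) (s.1 (1, 0))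
    rw [← integral_mul_right_eq_self
      (fun U : SU 2 => (‖(U : Matrix (Fin 2) (Fin 2) ℂ) 0 0‖ ^ 2) ^ k) V, ← integral_const_mul]
    refine integral_congr_ae (Filter.Eventually.of_forall fun U => ?_)
    have : actLeft U s.1 (0, 0) = n * ((U * V : SU 2) : Matrix (Fin 2) (Fin 2) ℂ) 0 0 := by
      rw [actLeft_apply, h0, h1, Submonoid.coe_mul, Matrix.mul_apply, Fin.sum_univ_two]
      ring
    simp only [this, norm_mul, Complex.norm_real, Real.norm_eq_abs, mul_pow, sq_abs, hn]
  simp only [hR, hL, integral_const, probReal_univ, integral_mul_const, smul_eq_mul, one_mul] at hswap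
  rw [integral_normSq_add_pow_haarPureState (0, 0) (1, 0) (by decide)] at hswap
  field_simp at hswap ⊢
  linarith

/-- `|U₀₀|²` is uniformly distributed on `[0, 1]` for a Haar-distributed `U ∈ SU(2)`. -/
theorem integral_comp_normSq_haarSU {φ : ℝ → ℝ} (hφ : Continuous φ) :
    ∫ U, φ (‖(U : Matrix (Fin 2) (Fin 2) ℂ) 0 0‖ ^ 2) ∂haarSU 2 = ∫ x in (0 : ℝ)..1, φ x := by
  have := integral_comp_eq_of_moments (μ := haarSU 2)
    (X := fun U => ‖(U : Matrix (Fin 2) (Fin 2) ℂ) 0 0‖ ^ 2) (Y := fun x => x) (w := fun _ => 1)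
    ((continuous_SU_apply 0 0).norm.pow 2).measurable
    (fun U => ⟨by positivity, by
      have := SU_norm_sq_row U 0
      nlinarith [sq_nonneg ‖(U : Matrix (Fin 2) (Fin 2) ℂ) 0 1‖]⟩)
    continuous_id continuous_const (fun x hx => hx)
    (fun k => by simp [integral_normSq_pow_haarSU]) hφ
  simpa using this

/-! ### The spectrum and the entropy of a qubit matrix -/

theorem H₂_eq (x : ℝ) : H₂ x = Real.negMulLog x / Real.log 2 + Real.negMulLog (1 - x) / Real.log 2 := by
  simp only [H₂, Real.negMulLog, Real.logb]
  ring

theorem continuous_H₂ : Continuous H₂ := by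
  rw [funext H₂_eq]
  have h := Real.continuous_negMulLog
  exact (h.div_const _).add ((h.comp (continuous_const.sub continuous_id)).div_const _)

theorem H₂_one_sub (x : ℝ) : H₂ (1 - x) = H₂ x := by
  simp only [H₂, sub_sub_cancel]
  ring

/-- The Bloch length of a qubit matrix of unit trace. -/
def blochRadius (M : Matrix (Fin 2) (Fin 2) ℂ) : ℝ := √(1 - 4 * M.det.re)

theorem continuous_blochRadius : Continuous blochRadius :=
  (continuous_const.sub (continuous_const.mul
    (Complex.continuous_re.comp (Continuous.matrix_det continuous_id)))).sqrt

theorem blochRadius_nonneg (M : Matrix (Fin 2) (Fin 2) ℂ) : 0 ≤ blochRadius M := Real.sqrt_nonneg _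

/-- A continuous expression for the entropy of a qubit state. -/
def qubitEntropy (M : Matrix (Fin 2) (Fin 2) ℂ) : ℝ := H₂ ((1 - blochRadius M) / 2)

theorem continuous_qubitEntropy : Continuous qubitEntropy :=
  continuous_H₂.comp ((continuous_const.sub continuous_blochRadius).div_const _)

theorem trace_mul_cfc {M : Matrix (Fin 2) (Fin 2) ℂ} (hM : M.IsHermitian) (f : ℝ → ℝ) :
    (M * cfc f M).trace = ((∑ i, hM.eigenvalues i * f (hM.eigenvalues i) : ℝ) : ℂ) := by
  rw [hM.cfc_eq, Matrix.IsHermitian.cfc]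
  nth_rewrite 1 [hM.spectral_theorem]
  rw [← map_mul, Unitary.conjStarAlgAut_apply, Matrix.trace_mul_comm, ← mul_assoc,
    Unitary.coe_star_mul_self, one_mul, diagonal_mul_diagonal, trace_diagonal]
  simp

theorem sum_eigenvalues_of_trace {M : Matrix (Fin 2) (Fin 2) ℂ} (hM : M.IsHermitian)
    (hT : M.trace = 1) : hM.eigenvalues 0 + hM.eigenvalues 1 = 1 := by
  have h := hM.trace_eq_sum_eigenvalues
  rw [hT, Fin.sum_univ_two] at h
  simpa using (congrArg Complex.re h).symm

theorem blochRadius_eq_abs {M : Matrix (Fin 2) (Fin 2) ℂ} (hM : M.IsHermitian)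
    (hT : M.trace = 1) : blochRadius M = |hM.eigenvalues 0 - hM.eigenvalues 1| := by
  have h := hM.det_eq_prod_eigenvalues
  rw [Fin.prod_univ_two] at h
  have h2 := sum_eigenvalues_of_trace hM hT
  have h3 : M.det.re = hM.eigenvalues 0 * hM.eigenvalues 1 := by
    rw [h]
    simp
  rw [blochRadius, h3, ← Real.sqrt_sq_eq_abs]
  congr 1
  have : hM.eigenvalues 1 = 1 - hM.eigenvalues 0 := by linarith
  rw [this]
  ring

/-- The symmetry `H₂ (1 - x) = H₂ x` makes the order of the two eigenvalues irrelevant. -/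
theorem vonNeumannEntropy_eq_qubitEntropy {M : Matrix (Fin 2) (Fin 2) ℂ} (hM : M.IsHermitian)
    (hT : M.trace = 1) : vonNeumannEntropy M = qubitEntropy M := by
  have h2 := sum_eigenvalues_of_trace hM hT
  have h1 : hM.eigenvalues 1 = 1 - hM.eigenvalues 0 := by linarith
  have hS : vonNeumannEntropy M = H₂ (hM.eigenvalues 0) := by
    rw [vonNeumannEntropy, trace_mul_cfc hM, Complex.ofReal_re, Fin.sum_univ_two, h1, H₂]
    ring
  rw [hS, qubitEntropy, blochRadius_eq_abs hM hT, h1]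
  rcases abs_choice (hM.eigenvalues 0 - (1 - hM.eigenvalues 0)) with h | h <;> rw [h]
  · rw [← H₂_one_sub]
    congr 1
    ring
  · congr 1
    ring

/-! ### Orbits -/

/-- The point `U diag(1 - a, a) U†` of the orbit `𝒪_a`. -/
def orbitState (a : ℝ) (U : SU 2) : Matrix (Fin 2) (Fin 2) ℂ :=
  (U : Matrix (Fin 2) (Fin 2) ℂ) * diagonal (fun i => ((![1 - a, a] i : ℝ) : ℂ)) *
    (U : Matrix (Fin 2) (Fin 2) ℂ)ᴴ

/-- Conjugation by `U`. -/
def conjSU (U : SU 2) (M : Matrix (Fin 2) (Fin 2) ℂ) : Matrix (Fin 2) (Fin 2) ℂ :=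
  (U : Matrix (Fin 2) (Fin 2) ℂ) * M * (U : Matrix (Fin 2) (Fin 2) ℂ)ᴴ

theorem conjSU_orbitState (a : ℝ) (U V : SU 2) :
    conjSU U (orbitState a V) = orbitState a (U * V) := by
  simp only [conjSU, orbitState, Submonoid.coe_mul, conjTranspose_mul, mul_assoc]

theorem det_conjSU (U : SU 2) (M : Matrix (Fin 2) (Fin 2) ℂ) : (conjSU U M).det = M.det := by
  rw [conjSU, det_mul, det_mul, det_conjTranspose, SU_det]
  simp

theorem blochRadius_conjSU (U : SU 2) (M : Matrix (Fin 2) (Fin 2) ℂ) :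
    blochRadius (conjSU U M) = blochRadius M := by
  rw [blochRadius, det_conjSU, blochRadius]

theorem qubitEntropy_conjSU (U : SU 2) (M : Matrix (Fin 2) (Fin 2) ℂ) :
    qubitEntropy (conjSU U M) = qubitEntropy M := by
  rw [qubitEntropy, blochRadius_conjSU, qubitEntropy]

theorem continuous_conjSU :
    Continuous fun p : SU 2 × Matrix (Fin 2) (Fin 2) ℂ => conjSU p.1 p.2 :=
  ((((continuous_coe_SU 2).comp continuous_fst).matrix_mul continuous_snd).matrix_mul
    ((continuous_coe_SU 2).comp continuous_fst).matrix_conjTranspose)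

theorem continuous_orbitState : Continuous fun p : ℝ × SU 2 => orbitState p.1 p.2 := by
  refine continuous_conjSU.comp (f := fun p : ℝ × SU 2 =>
    (p.2, diagonal (fun i => ((![1 - p.1, p.1] i : ℝ) : ℂ)))) ?_
  refine continuous_snd.prodMk (Continuous.matrix_diagonal (continuous_pi fun i => ?_))
  fin_cases i <;> simp <;> fun_prop

theorem isHermitian_orbitState (a : ℝ) (U : SU 2) : (orbitState a U).IsHermitian := by
  refine isHermitian_mul_mul_conjTranspose _ ?_
  rw [IsHermitian, diagonal_conjTranspose]
  congr 1
  ext i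
  simp

theorem trace_orbitState (a : ℝ) (U : SU 2) : (orbitState a U).trace = 1 := by
  rw [orbitState, Matrix.trace_mul_comm, ← mul_assoc, SU_conjTranspose_mul, one_mul,
    trace_diagonal, Fin.sum_univ_two]
  simp

theorem orbitState_apply_zero_zero (a : ℝ) (U : SU 2) : (orbitState a U) 0 0 =
    ((a + (1 - 2 * a) * ‖(U : Matrix (Fin 2) (Fin 2) ℂ) 0 0‖ ^ 2 : ℝ) : ℂ) := by
  have h : ((‖(U : Matrix (Fin 2) (Fin 2) ℂ) 0 1‖ ^ 2 : ℝ) : ℂ) =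
      ((1 - ‖(U : Matrix (Fin 2) (Fin 2) ℂ) 0 0‖ ^ 2 : ℝ) : ℂ) := by
    rw [← SU_norm_sq_row U 0]
    congr 1
    ring
  push_cast at h
  simp only [orbitState, Matrix.mul_apply, Fin.sum_univ_two, conjTranspose_apply, RCLike.star_def,
    diagonal_apply]
  simp
  simp only [← Complex.mul_conj'] at h ⊢
  linear_combination (a : ℂ) * h

theorem diagonal_ofReal_pair (x y : ℝ) :
    diagonal (fun i => ((![x, y] i : ℝ) : ℂ)) = !![(x : ℂ), 0; 0, (y : ℂ)] := by
  ext i j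
  fin_cases i <;> fin_cases j <;> simp

/-- The diagonalization of a Hermitian qubit matrix by an element of `SU(2)`. -/
theorem exists_eq_orbitState {M : Matrix (Fin 2) (Fin 2) ℂ} (hM : M.IsHermitian)
    (hT : M.trace = 1) : ∃ V : SU 2, M = orbitState ((1 - blochRadius M) / 2) V := by
  set W : Matrix (Fin 2) (Fin 2) ℂ := hM.eigenvectorUnitary.1 with hW
  have hWW : W * Wᴴ = 1 := Matrix.mem_unitaryGroup_iff.1 hM.eigenvectorUnitary.2
  have hdW : W.det * star W.det = 1 := by
    rw [← det_conjTranspose, ← det_mul, hWW, det_one]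
  have hspec : M = W * diagonal (fun i => (hM.eigenvalues i : ℂ)) * Wᴴ := by
    nth_rewrite 1 [hM.spectral_theorem]
    rw [Unitary.conjStarAlgAut_apply]
    rfl
  have h1 : hM.eigenvalues 1 = 1 - hM.eigenvalues 0 := by
    linarith [sum_eigenvalues_of_trace hM hT]
  have hdiag : diagonal (fun i => (hM.eigenvalues i : ℂ)) =
      !![(hM.eigenvalues 0 : ℂ), 0; 0, 1 - (hM.eigenvalues 0 : ℂ)] := by
    ext i j
    fin_cases i <;> fin_cases j <;> simp [h1]
  -- The eigenvector unitary `W` has a determinant of modulus one only. A factor `T` of determinant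
  -- `star W.det` corrects it; `T` is diagonal if the eigenvalues are already in the order `(1 - a,
  -- a)`, and antidiagonal if they must be exchanged.
  have mk : ∀ T : Matrix (Fin 2) (Fin 2) ℂ, ∀ a : ℝ, T * Tᴴ = 1 → T.det = star W.det →
      T * diagonal (fun i => ((![1 - a, a] i : ℝ) : ℂ)) * Tᴴ =
        diagonal (fun i => (hM.eigenvalues i : ℂ)) → ∃ V : SU 2, M = orbitState a V := by
    intro T a h1 h2 h3
    refine ⟨⟨W * T, ?_⟩, ?_⟩
    · rw [Matrix.mem_specialUnitaryGroup_iff, Matrix.mem_unitaryGroup_iff]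
      constructor
      · rw [star_eq_conjTranspose, conjTranspose_mul, mul_assoc, ← mul_assoc T, h1, one_mul, hWW]
      · rw [det_mul, h2, hdW]
    · rw [orbitState, hspec, ← h3]
      simp only [conjTranspose_mul, mul_assoc]
  rw [blochRadius_eq_abs hM hT, h1]
  have hdW' := hdW
  rw [RCLike.star_def] at hdW'
  rcases abs_choice (hM.eigenvalues 0 - (1 - hM.eigenvalues 0)) with h | h <;> rw [h]
  · refine mk !![1, 0; 0, star W.det] _ ?_ ?_ ?_
    · ext i j
      fin_cases i <;> fin_cases j <;> simp [Matrix.mul_apply, Fin.sum_univ_two]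
      linear_combination hdW'
    · simp [det_fin_two]
    · rw [hdiag, diagonal_ofReal_pair]
      ext i j
      fin_cases i <;> fin_cases j <;> simp [Matrix.mul_apply, Fin.sum_univ_two]
      · ring
      · linear_combination (1 - (hM.eigenvalues 0 : ℂ)) * hdW'
  · refine mk !![0, -star W.det; 1, 0] _ ?_ ?_ ?_
    · ext i j
      fin_cases i <;> fin_cases j <;> simp [Matrix.mul_apply, Fin.sum_univ_two]
      linear_combination hdW'
    · simp [det_fin_two]
    · rw [hdiag, diagonal_ofReal_pair]
      ext i j
      fin_cases i <;> fin_cases j <;> simp [Matrix.mul_apply, Fin.sum_univ_two]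
      · linear_combination (hM.eigenvalues 0 : ℂ) * hdW'
      · ring

/-- Averaging over conjugations only depends on the Bloch length. -/
theorem integral_conjSU {M : Matrix (Fin 2) (Fin 2) ℂ} (hM : M.IsHermitian) (hT : M.trace = 1)
    (f : Matrix (Fin 2) (Fin 2) ℂ → ℝ) :
    ∫ U, f (conjSU U M) ∂haarSU 2 =
      ∫ U, f (orbitState ((1 - blochRadius M) / 2) U) ∂haarSU 2 := by
  obtain ⟨V, hV⟩ := exists_eq_orbitState hM hT
  nth_rewrite 1 [hV]
  simp only [conjSU_orbitState]
  exact integral_mul_right_eq_self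
    (fun U => f (orbitState ((1 - blochRadius M) / 2) U)) V

/-- The third Bloch coordinate. -/
def blochZ (M : Matrix (Fin 2) (Fin 2) ℂ) : ℝ := 2 * (M 0 0).re - 1

theorem continuous_blochZ : Continuous blochZ :=
  (continuous_const.mul (Complex.continuous_re.comp (continuous_id.matrix_elem 0 0))).sub
    continuous_const

theorem integral_two_mul_sub_one_pow (k : ℕ) :
    ∫ x in (0 : ℝ)..1, (2 * x - 1) ^ (2 * k) = 1 / (2 * k + 1) := by
  rw [intervalIntegral.integral_comp_mul_sub (fun x => x ^ (2 * k)) two_ne_zero, integral_pow]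
  norm_num
  have : (-1 : ℝ) ^ (2 * k + 1) = -1 := by rw [pow_succ, pow_mul]; norm_num
  rw [this]
  field_simp
  norm_num

/-- Archimedes' theorem in moment form: after a Haar conjugation the third coordinate is `R (2x -
1)` with `x = |U₀₀|²` uniform. Even moments suffice because they are the moments of `R²`. -/
theorem integral_blochZ_pow_conjSU {M : Matrix (Fin 2) (Fin 2) ℂ} (hM : M.IsHermitian)
    (hT : M.trace = 1) (k : ℕ) :
    ∫ U, blochZ (conjSU U M) ^ (2 * k) ∂haarSU 2 = blochRadius M ^ (2 * k) / (2 * k + 1) := by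
  rw [integral_conjSU hM hT (fun M => blochZ M ^ (2 * k))]
  have : ∀ U : SU 2, blochZ (orbitState ((1 - blochRadius M) / 2) U) ^ (2 * k) =
      (fun x => blochRadius M ^ (2 * k) * (2 * x - 1) ^ (2 * k))
        (‖(U : Matrix (Fin 2) (Fin 2) ℂ) 0 0‖ ^ 2) := by
    intro U
    rw [blochZ, orbitState_apply_zero_zero, Complex.ofReal_re]
    simp only [← mul_pow]
    congr 1
    ring
  simp only [this]
  rw [integral_comp_normSq_haarSU (φ := fun x => blochRadius M ^ (2 * k) * (2 * x - 1) ^ (2 * k))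
    (by fun_prop), intervalIntegral.integral_const_mul, integral_two_mul_sub_one_pow]
  ring

/-! ### Averages over compact parameter spaces -/

instance instLocallyCompactSpaceMatrix : LocallyCompactSpace (Matrix (Fin 2) (Fin 2) ℂ) :=
  inferInstanceAs (LocallyCompactSpace (Fin 2 → Fin 2 → ℂ))

theorem continuous_integral_of_compactSpace {X Y : Type*} [TopologicalSpace X]
    [FirstCountableTopology X] [LocallyCompactSpace X] [TopologicalSpace Y] [CompactSpace Y]
    [MeasurableSpace Y] [OpensMeasurableSpace Y] {μ : Measure Y}
    [IsFiniteMeasure μ] {f : X → Y → ℝ} (hf : Continuous f.uncurry) :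
    Continuous fun x => ∫ y, f x y ∂μ := by
  have := continuous_parametric_integral_of_continuous (μ := μ) hf isCompact_univ
  simpa using this

/-- The entropy `F`, defined by functional calculus, is replaced by a continuous `K` that agrees
with it only on actual states. This is enough because the image measure is carried by the compact
range of `Prod.map u v`. -/
theorem integral_prod_map_of_continuous {X Y : Type*} [TopologicalSpace X] [CompactSpace X]
    [SecondCountableTopology X] [MeasurableSpace X] [BorelSpace X] [TopologicalSpace Y]
    [CompactSpace Y] [SecondCountableTopology Y] [MeasurableSpace Y] [BorelSpace Y]
    {μ : Measure X} {ν : Measure Y} [IsFiniteMeasure μ] [IsFiniteMeasure ν]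
    {u : X → Matrix (Fin 2) (Fin 2) ℂ} {v : Y → Matrix (Fin 2) (Fin 2) ℂ} (hu : Continuous u)
    (hv : Continuous v) {F K : Matrix (Fin 2) (Fin 2) ℂ × Matrix (Fin 2) (Fin 2) ℂ → ℝ}
    (hK : Continuous K) (hFK : ∀ x y, F (u x, v y) = K (u x, v y)) :
    Integrable F ((μ.map u).prod (ν.map v)) ∧
      ∫ p, F p ∂((μ.map u).prod (ν.map v)) = ∫ x, ∫ y, K (u x, v y) ∂ν ∂μ := by
  have huv : Continuous (Prod.map u v) := hu.prodMap hv
  have hKi : Integrable (fun p : X × Y => K (Prod.map u v p)) (μ.prod ν) :=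
    integrable_of_continuous_compactSpace (hK.comp huv)
  rw [Measure.map_prod_map _ _ hu.measurable hv.measurable]
  have hae : F =ᵐ[(μ.prod ν).map (Prod.map u v)] K := by
    have hr : ∀ᵐ p ∂(μ.prod ν).map (Prod.map u v), p ∈ Set.range (Prod.map u v) :=
      (ae_map_iff (p := (· ∈ Set.range (Prod.map u v))) huv.measurable.aemeasurable
        (isCompact_range huv).measurableSet).2 (Filter.Eventually.of_forall fun p => ⟨p, rfl⟩)
    filter_upwards [hr] with p hp
    obtain ⟨⟨x, y⟩, rfl⟩ := hp
    exact hFK x y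
  constructor
  · rw [integrable_congr hae, integrable_map_measure hK.aestronglyMeasurable
      huv.measurable.aemeasurable]
    exact hKi
  · rw [integral_congr_ae hae, integral_map huv.measurable.aemeasurable hK.aestronglyMeasurable,
      integral_prod _ hKi]
    rfl

/-- The equiprobable mixture. -/
def mix (M N : Matrix (Fin 2) (Fin 2) ℂ) : Matrix (Fin 2) (Fin 2) ℂ := (1 / 2 : ℂ) • (M + N)

theorem continuous_mix :
    Continuous fun p : Matrix (Fin 2) (Fin 2) ℂ × Matrix (Fin 2) (Fin 2) ℂ => mix p.1 p.2 := by
  unfold mix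
  fun_prop

theorem isHermitian_mix {M N : Matrix (Fin 2) (Fin 2) ℂ} (hM : M.IsHermitian)
    (hN : N.IsHermitian) : (mix M N).IsHermitian := by
  rw [IsHermitian, mix, conjTranspose_smul, (hM.add hN).eq]
  simp

theorem trace_mix {M N : Matrix (Fin 2) (Fin 2) ℂ} (hM : M.trace = 1) (hN : N.trace = 1) :
    (mix M N).trace = 1 := by
  rw [mix, trace_smul, trace_add, hM, hN]
  norm_num

theorem conjSU_mix (U : SU 2) (M N : Matrix (Fin 2) (Fin 2) ℂ) :
    conjSU U (mix M N) = mix (conjSU U M) (conjSU U N) := by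
  simp only [conjSU, mix, mul_smul_comm, smul_mul_assoc, mul_add, add_mul]

theorem isHermitian_diagPart {M : Matrix (Fin 2) (Fin 2) ℂ} (hM : M.IsHermitian) :
    (diagPart M).IsHermitian := by
  rw [IsHermitian, diagPart, diagonal_conjTranspose]
  congr 1
  ext i
  exact hM.apply i i

theorem trace_diagPart (M : Matrix (Fin 2) (Fin 2) ℂ) : (diagPart M).trace = M.trace := by
  simp [diagPart, trace]

theorem mix_diagPart (M N : Matrix (Fin 2) (Fin 2) ℂ) :
    mix (diagPart M) (diagPart N) = diagPart (mix M N) := by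
  ext i j
  by_cases h : i = j <;> simp [mix, diagPart, h]

theorem qubitEntropy_diagPart {M : Matrix (Fin 2) (Fin 2) ℂ} (hM : M.IsHermitian)
    (hT : M.trace = 1) : qubitEntropy (diagPart M) = H₂ (M 0 0).re := by
  have h0 : ((M 0 0).re : ℂ) = M 0 0 := hM.coe_re_apply_self 0
  have h1 : M 1 1 = 1 - M 0 0 := by
    rw [trace_fin_two] at hT
    linear_combination hT
  have hd : (diagPart M).det.re = (M 0 0).re * (1 - (M 0 0).re) := by
    rw [diagPart, det_diagonal, Fin.prod_univ_two, h1, ← h0]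
    norm_cast
  have hr : blochRadius (diagPart M) = |1 - 2 * (M 0 0).re| := by
    rw [blochRadius, hd, ← Real.sqrt_sq_eq_abs]
    congr 1
    ring
  rw [qubitEntropy, hr]
  rcases abs_choice (1 - 2 * (M 0 0).re) with h | h <;> rw [h]
  · congr 1
    ring
  · rw [← H₂_one_sub]
    congr 1
    ring

theorem vonNeumannEntropy_diagPart_mix {M N : Matrix (Fin 2) (Fin 2) ℂ} (hM : M.IsHermitian)
    (hMT : M.trace = 1) (hN : N.IsHermitian) (hNT : N.trace = 1) :
    vonNeumannEntropy (diagPart (mix M N)) = H₂ (((M 0 0).re + (N 0 0).re) / 2) := by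
  have hH := isHermitian_mix hM hN
  have hT := trace_mix hMT hNT
  rw [vonNeumannEntropy_eq_qubitEntropy (isHermitian_diagPart hH) (by rw [trace_diagPart, hT]),
    qubitEntropy_diagPart hH hT]
  congr 1
  simp [mix]
  ring

section Averages

variable {X Y : Type*} [TopologicalSpace X] [CompactSpace X]
  [SecondCountableTopology X] [MeasurableSpace X] [BorelSpace X] [TopologicalSpace Y]
  [CompactSpace Y] [SecondCountableTopology Y] [MeasurableSpace Y] [BorelSpace Y]
  {μ : Measure X} {ν : Measure Y} [IsFiniteMeasure μ] [IsFiniteMeasure ν]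
  {u : X → Matrix (Fin 2) (Fin 2) ℂ} {v : Y → Matrix (Fin 2) (Fin 2) ℂ}

theorem integral_vonNeumannEntropy_map (hu : Continuous u) (hv : Continuous v)
    (hu1 : ∀ x, (u x).IsHermitian ∧ (u x).trace = 1)
    (hv1 : ∀ y, (v y).IsHermitian ∧ (v y).trace = 1) :
    Integrable (fun p => vonNeumannEntropy (mix p.1 p.2)) ((μ.map u).prod (ν.map v)) ∧
      avgEntropy (μ.map u) (ν.map v) = ∫ x, ∫ y, qubitEntropy (mix (u x) (v y)) ∂ν ∂μ :=
  integral_prod_map_of_continuous hu hv (K := fun p => qubitEntropy (mix p.1 p.2))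
    (continuous_qubitEntropy.comp continuous_mix) fun x y =>
      vonNeumannEntropy_eq_qubitEntropy (isHermitian_mix (hu1 x).1 (hv1 y).1)
        (trace_mix (hu1 x).2 (hv1 y).2)

theorem integral_vonNeumannEntropy_diagPart_map (hu : Continuous u) (hv : Continuous v)
    (hu1 : ∀ x, (u x).IsHermitian ∧ (u x).trace = 1)
    (hv1 : ∀ y, (v y).IsHermitian ∧ (v y).trace = 1) :
    Integrable (fun p => vonNeumannEntropy (diagPart (mix p.1 p.2)))
        ((μ.map u).prod (ν.map v)) ∧
      avgDiagEntropy (μ.map u) (ν.map v) =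
        ∫ x, ∫ y, H₂ (((u x 0 0).re + (v y 0 0).re) / 2) ∂ν ∂μ := by
  have h := integral_prod_map_of_continuous (μ := μ) (ν := ν) hu hv
    (F := fun p => vonNeumannEntropy (diagPart (mix p.1 p.2)))
    (K := fun p => H₂ (((p.1 0 0).re + (p.2 0 0).re) / 2))
    (continuous_H₂.comp (((Complex.continuous_re.comp (continuous_fst.matrix_elem 0 0)).add
      (Complex.continuous_re.comp (continuous_snd.matrix_elem 0 0))).div_const _)) fun x y =>
        vonNeumannEntropy_diagPart_mix (hu1 x).1 (hu1 x).2 (hv1 y).1 (hv1 y).2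
  refine ⟨h.1, ?_⟩
  rw [← h.2, avgDiagEntropy]
  simp only [← mix_diagPart]
  rfl

theorem avgCoherence_map (hu : Continuous u) (hv : Continuous v)
    (hu1 : ∀ x, (u x).IsHermitian ∧ (u x).trace = 1)
    (hv1 : ∀ y, (v y).IsHermitian ∧ (v y).trace = 1) :
    avgCoherence (μ.map u) (ν.map v) =
      avgDiagEntropy (μ.map u) (ν.map v) - avgEntropy (μ.map u) (ν.map v) := by
  have h1 := integral_vonNeumannEntropy_map (μ := μ) (ν := ν) hu hv hu1 hv1
  have h2 := integral_vonNeumannEntropy_diagPart_map (μ := μ) (ν := ν) hu hv hu1 hv1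
  have h3 := integral_sub h2.1 h1.1
  simp only [← mix_diagPart] at h3
  rw [avgDiagEntropy, avgEntropy, avgCoherence]
  simp only [relEntropyCoherence]
  refine Eq.trans ?_ h3
  simp only [mix_diagPart]
  rfl

end Averages

theorem continuous_orbitState_right (a : ℝ) : Continuous (orbitState a) :=
  continuous_orbitState.comp (f := fun U : SU 2 => (a, U)) (continuous_const.prodMk continuous_id)

instance instSecondCountableTopologySU (d : ℕ) : SecondCountableTopology (SU d) :=
  TopologicalSpace.Subtype.secondCountableTopology _

theorem avgEntropy_qubitOrbit (a b : ℝ) : avgEntropy (qubitOrbit a) (qubitOrbit b) =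
    ∫ U, ∫ V, qubitEntropy (mix (orbitState a U) (orbitState b V)) ∂haarSU 2 ∂haarSU 2 :=
  (integral_vonNeumannEntropy_map (continuous_orbitState_right a) (continuous_orbitState_right b)
    (fun U => ⟨isHermitian_orbitState a U, trace_orbitState a U⟩)
    (fun U => ⟨isHermitian_orbitState b U, trace_orbitState b U⟩)).2

theorem avgDiagEntropy_qubitOrbit (a b : ℝ) : avgDiagEntropy (qubitOrbit a) (qubitOrbit b) =
    ∫ U, ∫ V, H₂ (((orbitState a U 0 0).re + (orbitState b V 0 0).re) / 2)
      ∂haarSU 2 ∂haarSU 2 :=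
  (integral_vonNeumannEntropy_diagPart_map (continuous_orbitState_right a)
    (continuous_orbitState_right b)
    (fun U => ⟨isHermitian_orbitState a U, trace_orbitState a U⟩)
    (fun U => ⟨isHermitian_orbitState b U, trace_orbitState b U⟩)).2

/-! ### The ensemble `ℰ_{2,2}` -/

/-- The reduced state of the first qubit. -/
def reducedState (ψ : TwoQubit) : Matrix (Fin 2) (Fin 2) ℂ := partialTrace (ketBra ψ)

theorem reducedState_eq (ψ : TwoQubit) : reducedState ψ =
    (Matrix.of fun i j => ψ (i, j)) * (Matrix.of fun i j => ψ (i, j) : Matrix (Fin 2) (Fin 2) ℂ)ᴴ := by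
  ext i j
  simp [reducedState, partialTrace, ketBra, Matrix.mul_apply]

open scoped ComplexOrder in
theorem posSemidef_reducedState (ψ : TwoQubit) : (reducedState ψ).PosSemidef := by
  rw [reducedState_eq]
  exact posSemidef_self_mul_conjTranspose _

theorem reducedState_apply_self (ψ : TwoQubit) (i : Fin 2) :
    reducedState ψ i i = ((‖ψ (i, 0)‖ ^ 2 + ‖ψ (i, 1)‖ ^ 2 : ℝ) : ℂ) := by
  simp [reducedState_eq, Matrix.mul_apply, Fin.sum_univ_two, Complex.mul_conj']

theorem sum_norm_sq_pureTwoQubit (s : PureTwoQubit) :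
    ‖s.1 (0, 0)‖ ^ 2 + ‖s.1 (0, 1)‖ ^ 2 + (‖s.1 (1, 0)‖ ^ 2 + ‖s.1 (1, 1)‖ ^ 2) = 1 := by
  have h : ‖s.1‖ ^ 2 = 1 := by simp
  rw [EuclideanSpace.norm_sq_eq, Fintype.sum_prod_type, Fin.sum_univ_two, Fin.sum_univ_two,
    Fin.sum_univ_two] at h
  exact h

theorem trace_reducedState (s : PureTwoQubit) : (reducedState s.1).trace = 1 := by
  rw [trace_fin_two, reducedState_apply_self, reducedState_apply_self, ← Complex.ofReal_add,
    sum_norm_sq_pureTwoQubit, Complex.ofReal_one]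

theorem continuous_reducedState : Continuous fun s : PureTwoQubit => reducedState s.1 := by
  have h : Continuous fun s : PureTwoQubit =>
      (Matrix.of fun i j => s.1 (i, j) : Matrix (Fin 2) (Fin 2) ℂ) :=
    continuous_matrix fun i j => continuous_pureTwoQubit_apply (i, j)
  simp only [reducedState_eq]
  exact h.matrix_mul h.matrix_conjTranspose

theorem reducedState_actLeft (U : SU 2) (ψ : TwoQubit) :
    reducedState (actLeft U ψ) = conjSU U (reducedState ψ) := by
  have h : (Matrix.of fun i j => actLeft U ψ (i, j) : Matrix (Fin 2) (Fin 2) ℂ) =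
      (U : Matrix (Fin 2) (Fin 2) ℂ) * Matrix.of fun i j => ψ (i, j) := by
    ext i j
    simp [actLeft_apply, Matrix.mul_apply, Fin.sum_univ_two]
  rw [reducedState_eq, h, conjSU, reducedState_eq, conjTranspose_mul]
  simp only [mul_assoc]

/-- A diagonal entry of a state of `ℰ_{2,2}` has density `6x(1-x)` on `[0, 1]`. -/
theorem integral_comp_reducedState_zero_zero {φ : ℝ → ℝ} (hφ : Continuous φ) :
    ∫ s : PureTwoQubit, φ (reducedState s.1 0 0).re ∂haarPureState 2 2 =
      ∫ x in (0 : ℝ)..1, φ x * (6 * x * (1 - x)) := by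
  simp only [reducedState_apply_self, Complex.ofReal_re]
  refine integral_comp_eq_of_moments (Y := fun x => x)
    (X := fun s : PureTwoQubit => ‖s.1 (0, 0)‖ ^ 2 + ‖s.1 (0, 1)‖ ^ 2)
    (((continuous_pureTwoQubit_apply (0, 0)).norm.pow 2).add
      ((continuous_pureTwoQubit_apply (0, 1)).norm.pow 2)).measurable (fun s => ⟨by positivity, ?_⟩)
    continuous_id (by fun_prop) (fun x hx => hx) (fun k => ?_) hφ
  · have := sum_norm_sq_pureTwoQubit s
    have h2 : 0 ≤ ‖s.1 (1, 0)‖ ^ 2 + ‖s.1 (1, 1)‖ ^ 2 := by positivity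
    linarith
  · rw [integral_normSq_add_pow_haarPureState (0, 0) (0, 1) (by decide)]
    have : ∀ x : ℝ, x ^ k * (6 * x * (1 - x)) = 6 * x ^ (k + 1) - 6 * x ^ (k + 2) := by
      intro x
      ring
    simp only [this]
    rw [intervalIntegral.integral_sub (Continuous.intervalIntegrable (by fun_prop) _ _)
      (Continuous.intervalIntegrable (by fun_prop) _ _)]
    simp only [intervalIntegral.integral_const_mul, integral_pow]
    push_cast
    field_simp
    norm_num
    ring

/-! ### Disintegration of `ℰ_{2,2}` over the spectra -/

open scoped ComplexOrder in
theorem blochRadius_mem_Icc {M : Matrix (Fin 2) (Fin 2) ℂ} (hM : M.PosSemidef) :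
    blochRadius M ∈ Set.Icc (0 : ℝ) 1 := by
  have h : 0 ≤ M.det.re := (RCLike.nonneg_iff.1 hM.det_nonneg).1
  refine ⟨blochRadius_nonneg M, ?_⟩
  exact Real.sqrt_le_iff.2 ⟨zero_le_one, by linarith⟩

theorem sq_mem_Icc {x : ℝ} (hx : x ∈ Set.Icc (0 : ℝ) 1) : x ^ 2 ∈ Set.Icc (0 : ℝ) 1 :=
  ⟨sq_nonneg x, pow_le_one₀ hx.1 hx.2⟩

open scoped ComplexOrder in
theorem isHermitian_reducedState (ψ : TwoQubit) : (reducedState ψ).IsHermitian :=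
  (posSemidef_reducedState ψ).isHermitian

/-- The vector `(U ⊗ 1)ψ` has the law of `ψ`, and its reduced state is the conjugate by `U`; average
over `U` and exchange the integrals. -/
theorem integral_reducedState_eq_integral_conjSU {f : Matrix (Fin 2) (Fin 2) ℂ → ℝ}
    (hf : Continuous f) :
    ∫ s : PureTwoQubit, f (reducedState s.1) ∂haarPureState 2 2 =
      ∫ s : PureTwoQubit, ∫ U, f (conjSU U (reducedState s.1)) ∂haarSU 2 ∂haarPureState 2 2 := by
  rw [integral_integral_swap]
  · simp only [← reducedState_actLeft]
    have : ∀ U : SU 2, ∫ s : PureTwoQubit, f (reducedState (actLeft U s.1)) ∂haarPureState 2 2 =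
        ∫ s : PureTwoQubit, f (reducedState s.1) ∂haarPureState 2 2 := fun U =>
      integral_haarPureState_actLeft U fun ψ => f (reducedState ψ)
    simp only [this, integral_const, probReal_univ, one_smul]
  · exact integrable_of_continuous_compactSpace (hf.comp (continuous_conjSU.comp
      (f := fun p : PureTwoQubit × SU 2 => (p.2, reducedState p.1.1))
      (continuous_snd.prodMk (continuous_reducedState.comp continuous_fst))))

/-- Here `E[R^{2k}] = (2k + 1) E[Z^{2k}]` with `Z = 2x - 1` and `x` of density `6x(1-x)`. The result
is the `2k`-th moment of the density `3r²`. -/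
theorem integral_blochRadius_pow_reducedState (k : ℕ) :
    ∫ s : PureTwoQubit, (blochRadius (reducedState s.1) ^ 2) ^ k ∂haarPureState 2 2 =
      3 / (2 * k + 3) := by
  have h := integral_reducedState_eq_integral_conjSU (f := fun M => blochZ M ^ (2 * k))
    (continuous_blochZ.pow _)
  simp only [integral_blochZ_pow_conjSU (isHermitian_reducedState _) (trace_reducedState _),
    integral_div] at h
  simp only [blochZ] at h
  rw [integral_comp_reducedState_zero_zero (φ := fun x => (2 * x - 1) ^ (2 * k))
    (by fun_prop)] at h
  have hx : ∀ x : ℝ, (2 * x - 1) ^ (2 * k) * (6 * x * (1 - x)) =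
      3 / 2 * (2 * x - 1) ^ (2 * k) - 3 / 2 * (2 * x - 1) ^ (2 * (k + 1)) := by
    intro x
    rw [mul_add, pow_add]
    ring
  simp only [hx] at h
  rw [intervalIntegral.integral_sub (Continuous.intervalIntegrable (by fun_prop) _ _)
    (Continuous.intervalIntegrable (by fun_prop) _ _)] at h
  simp only [intervalIntegral.integral_const_mul, integral_two_mul_sub_one_pow] at h
  simp only [← pow_mul]
  push_cast at h
  rw [eq_div_iff (by positivity)] at h
  rw [eq_div_iff (by positivity), ← h]
  field_simp
  ring

/-- The ensemble `ℰ_{2,2}` is the mixture of the orbits `𝒪_{(1-r)/2}` with density `3r²`. -/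
theorem integral_reducedState_eq_integral_orbitState {f : Matrix (Fin 2) (Fin 2) ℂ → ℝ}
    (hf : Continuous f) :
    ∫ s : PureTwoQubit, f (reducedState s.1) ∂haarPureState 2 2 =
      ∫ r in (0 : ℝ)..1, (∫ U, f (orbitState ((1 - r) / 2) U) ∂haarSU 2) * (3 * r ^ 2) := by
  have hG : Continuous fun r : ℝ => ∫ U, f (orbitState ((1 - r) / 2) U) ∂haarSU 2 :=
    continuous_integral_of_compactSpace (hf.comp (continuous_orbitState.comp
      (f := fun p : ℝ × SU 2 => ((1 - p.1) / 2, p.2)) (by fun_prop)))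
  -- Only moments of `R²` are known, so the test function is the orbit average composed with the
  -- square root, and `Y r = r ^ 2`.
  have h := integral_comp_eq_of_moments (μ := haarPureState 2 2)
    (X := fun s : PureTwoQubit => blochRadius (reducedState s.1) ^ 2)
    (Y := fun r => r ^ 2) (w := fun r => 3 * r ^ 2)
    ((continuous_blochRadius.comp continuous_reducedState).pow 2).measurable
    (fun s => sq_mem_Icc (blochRadius_mem_Icc (posSemidef_reducedState s.1)))
    (by fun_prop) (by fun_prop) (fun x hx => sq_mem_Icc hx) (fun k => by
      rw [integral_blochRadius_pow_reducedState]
      have : ∀ x : ℝ, (x ^ 2) ^ k * (3 * x ^ 2) = 3 * x ^ (2 * k + 2) := by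
        intro x
        rw [← pow_mul, pow_add]
        ring
      simp only [this, intervalIntegral.integral_const_mul, integral_pow]
      push_cast
      norm_num
      ring) (hG.comp Real.continuous_sqrt)
  rw [integral_reducedState_eq_integral_conjSU hf]
  simp only [integral_conjSU (isHermitian_reducedState _) (trace_reducedState _)]
  simp only [Function.comp_def, Real.sqrt_sq (blochRadius_nonneg _)] at h
  rw [h]
  refine intervalIntegral.integral_congr fun r hr => ?_
  rw [Set.uIcc_of_le zero_le_one] at hr
  simp only [Real.sqrt_sq hr.1]

/-- The one-state disintegration is applied to each variable in turn; Fubini first rewrites the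
remaining average as a continuous function of a single matrix. -/
theorem integral_integral_reducedState_eq {K : Matrix (Fin 2) (Fin 2) ℂ →
    Matrix (Fin 2) (Fin 2) ℂ → ℝ} (hK : Continuous K.uncurry) :
    ∫ s : PureTwoQubit, ∫ t : PureTwoQubit, K (reducedState s.1) (reducedState t.1)
        ∂haarPureState 2 2 ∂haarPureState 2 2 =
      ∫ r₁ in (0 : ℝ)..1, ∫ r₂ in (0 : ℝ)..1,
        (∫ U, ∫ V, K (orbitState ((1 - r₁) / 2) U) (orbitState ((1 - r₂) / 2) V)
          ∂haarSU 2 ∂haarSU 2) * (3 * r₁ ^ 2) * (3 * r₂ ^ 2) := by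
  have hcomp : ∀ {Z : Type} [TopologicalSpace Z] {a b : Z → Matrix (Fin 2) (Fin 2) ℂ},
      Continuous a → Continuous b → Continuous fun z => K (a z) (b z) :=
    fun ha hb => hK.comp (ha.prodMk hb)
  have h1 : Continuous fun M => ∫ t : PureTwoQubit, K M (reducedState t.1) ∂haarPureState 2 2 :=
    continuous_integral_of_compactSpace
      (hcomp continuous_fst (continuous_reducedState.comp continuous_snd))
  rw [integral_reducedState_eq_integral_orbitState h1]
  refine intervalIntegral.integral_congr fun r₁ _ => ?_
  have h2 : Continuous fun N => ∫ U, K (orbitState ((1 - r₁) / 2) U) N ∂haarSU 2 :=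
    continuous_integral_of_compactSpace
      (hcomp ((continuous_orbitState_right _).comp continuous_snd) continuous_fst)
  have hswap : ∫ U, ∫ t : PureTwoQubit, K (orbitState ((1 - r₁) / 2) U) (reducedState t.1)
      ∂haarPureState 2 2 ∂haarSU 2 = ∫ t : PureTwoQubit, ∫ U,
        K (orbitState ((1 - r₁) / 2) U) (reducedState t.1) ∂haarSU 2 ∂haarPureState 2 2 :=
    integral_integral_swap (integrable_of_continuous_compactSpace
      (hcomp ((continuous_orbitState_right _).comp continuous_fst)
        (continuous_reducedState.comp continuous_snd)))
  simp only [hswap]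
  rw [integral_reducedState_eq_integral_orbitState h2, ← intervalIntegral.integral_mul_const]
  refine intervalIntegral.integral_congr fun r₂ _ => ?_
  have hswap2 : ∫ V, ∫ U, K (orbitState ((1 - r₁) / 2) U) (orbitState ((1 - r₂) / 2) V)
      ∂haarSU 2 ∂haarSU 2 = ∫ U, ∫ V,
        K (orbitState ((1 - r₁) / 2) U) (orbitState ((1 - r₂) / 2) V) ∂haarSU 2 ∂haarSU 2 :=
    integral_integral_swap (integrable_of_continuous_compactSpace
      (hcomp ((continuous_orbitState_right _).comp continuous_snd)
        ((continuous_orbitState_right _).comp continuous_fst)))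
  simp only [hswap2]
  ring

/-! ### The law of the diagonal entry of a mixture of states of `ℰ_{2,2}` -/

theorem integral_integral_reducedState_zero_zero {g : ℝ → ℝ → ℝ} (hg : Continuous g.uncurry) :
    ∫ s : PureTwoQubit, ∫ t : PureTwoQubit, g (reducedState s.1 0 0).re (reducedState t.1 0 0).re
        ∂haarPureState 2 2 ∂haarPureState 2 2 =
      ∫ x in (0 : ℝ)..1, (∫ y in (0 : ℝ)..1, g x y * (6 * y * (1 - y))) * (6 * x * (1 - x)) := by
  have hgx : ∀ x, Continuous (g x) := fun x => hg.comp (by fun_prop : Continuous fun y => (x, y))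
  simp only [integral_comp_reducedState_zero_zero (hgx _)]
  refine integral_comp_reducedState_zero_zero
    (φ := fun x => ∫ y in (0 : ℝ)..1, g x y * (6 * y * (1 - y))) ?_
  refine intervalIntegral.continuous_parametric_intervalIntegral_of_continuous'
    (f := fun x y => g x y * (6 * y * (1 - y))) ?_ 0 1
  exact hg.mul (by fun_prop)

/-- The density `6x(1-x)` on `[0, 1]`, extended by zero. -/
def betaDensity (x : ℝ) : ℝ := max (6 * x * (1 - x)) 0

theorem continuous_betaDensity : Continuous betaDensity := by
  unfold betaDensity
  fun_prop

theorem betaDensity_of_mem {x : ℝ} (h0 : 0 ≤ x) (h1 : x ≤ 1) :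
    betaDensity x = 6 * x * (1 - x) :=
  max_eq_left (by have := mul_nonneg h0 (sub_nonneg.2 h1); linarith)

theorem betaDensity_of_notMem {x : ℝ} (hx : x ∉ Set.Icc (0 : ℝ) 1) : betaDensity x = 0 := by
  refine max_eq_right ?_
  rw [Set.mem_Icc, not_and_or, not_le, not_le] at hx
  rcases hx with h | h <;> nlinarith

theorem betaDensity_one_sub (x : ℝ) : betaDensity (1 - x) = betaDensity x := by
  unfold betaDensity
  congr 1
  ring

theorem integral_mul_betaDensity (g : ℝ → ℝ) :
    ∫ x, g x * betaDensity x = ∫ x in (0 : ℝ)..1, g x * (6 * x * (1 - x)) := by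
  rw [intervalIntegral.integral_of_le zero_le_one, ← integral_Icc_eq_integral_Ioc,
    ← setIntegral_eq_integral_of_forall_compl_eq_zero (s := Set.Icc (0 : ℝ) 1)]
  · refine setIntegral_congr_fun measurableSet_Icc fun x hx => ?_
    simp only [betaDensity_of_mem hx.1 hx.2]
  · intro x hx
    rw [betaDensity_of_notMem hx, mul_zero]

/-- The self-convolution of the density of a diagonal entry, as a function of the third Bloch
coordinate. -/
def diagDensity (z : ℝ) : ℝ := ∫ x, betaDensity (z + 1 - x) * betaDensity x

theorem diagDensity_neg (z : ℝ) : diagDensity (-z) = diagDensity z := by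
  rw [diagDensity, ← integral_sub_left_eq_self _ _ 1]
  refine integral_congr_ae (Filter.Eventually.of_forall fun x => ?_)
  simp only [betaDensity_one_sub]
  rw [← betaDensity_one_sub]
  congr 2
  ring

theorem diagDensity_of_one_le {z : ℝ} (hz : 1 < z) : diagDensity z = 0 := by
  rw [diagDensity]
  refine integral_eq_zero_of_ae (Filter.Eventually.of_forall fun x => ?_)
  by_cases hx : x ∈ Set.Icc (0 : ℝ) 1
  · have : z + 1 - x ∉ Set.Icc (0 : ℝ) 1 := fun h => by linarith [h.2, hx.2]
    simp [betaDensity_of_notMem this]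
  · simp [betaDensity_of_notMem hx]

/-- Both factors live on `[0, 1]` together exactly for `x ∈ [z, 1]`, where the integrand is a
polynomial. -/
theorem diagDensity_of_mem {z : ℝ} (h0 : 0 ≤ z) (h1 : z ≤ 1) :
    diagDensity z = 6 / 5 * (1 - z ^ 5) + 6 * z ^ 3 - 6 * z ^ 2 := by
  have h : diagDensity z = ∫ x in z..1,
      36 * (x ^ 4 - (2 * z + 2) * x ^ 3 + (z ^ 2 + 3 * z + 1) * x ^ 2 - (z ^ 2 + z) * x) := by
    rw [diagDensity, intervalIntegral.integral_of_le h1, ← integral_Icc_eq_integral_Ioc,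
      ← setIntegral_eq_integral_of_forall_compl_eq_zero (s := Set.Icc z 1)]
    · refine setIntegral_congr_fun measurableSet_Icc fun x hx => ?_
      simp only [betaDensity_of_mem (h0.trans hx.1) hx.2]
      rw [betaDensity_of_mem (by linarith [hx.2]) (by linarith [hx.1])]
      ring
    · intro x hx
      by_cases h : x ∈ Set.Icc (0 : ℝ) 1
      · have : z + 1 - x ∉ Set.Icc (0 : ℝ) 1 := fun h' => hx ⟨by linarith [h'.2], h.2⟩
        rw [betaDensity_of_notMem this, zero_mul]
      · rw [betaDensity_of_notMem h, mul_zero]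
  rw [h, intervalIntegral.integral_eq_sub_of_hasDerivAt
    (f := fun x => 36 * (x ^ 5 / 5 - (2 * z + 2) * (x ^ 4 / 4) + (z ^ 2 + 3 * z + 1) * (x ^ 3 / 3) -
      (z ^ 2 + z) * (x ^ 2 / 2)))]
  · ring
  · intro x _
    have hp : ∀ n : ℕ, HasDerivAt (fun x : ℝ => x ^ (n + 1) / (n + 1)) (x ^ n) x := by
      intro n
      have := (hasDerivAt_pow (n + 1) x).div_const ((n : ℝ) + 1)
      have e : x ^ n = ((n + 1 : ℕ) : ℝ) * x ^ (n + 1 - 1) / ((n : ℝ) + 1) := by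
        rw [Nat.add_sub_cancel]
        push_cast
        field_simp
      rw [e]
      exact this
    have h4 := hp 4
    have h3 := hp 3
    have h2 := hp 2
    have h1 := hp 1
    norm_num at h1 h2 h3 h4
    exact (((h4.sub (h3.const_mul _)).add (h2.const_mul _)).sub (h1.const_mul _)).const_mul _
  · exact Continuous.intervalIntegrable (by fun_prop) _ _

/-- Substituting `w = x + y - 1` and exchanging the integrals exhibits the self-convolution
`diagDensity`. As it and `f` are even, the line folds onto the half-line, and the support reduces
this to `[0, 1]`. -/
theorem integral_integral_even_betaDensity {f : ℝ → ℝ} (hf : Continuous f)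
    (heven : ∀ x, f (-x) = f x) :
    ∫ x in (0 : ℝ)..1, (∫ y in (0 : ℝ)..1, f (x + y - 1) * (6 * y * (1 - y))) * (6 * x * (1 - x)) =
      2 * ∫ z in (0 : ℝ)..1, f z * (6 / 5 * (1 - z ^ 5) + 6 * z ^ 3 - 6 * z ^ 2) := by
  rw [← integral_mul_betaDensity]
  simp only [← integral_mul_betaDensity]
  have h1 : ∀ x : ℝ, (∫ y, f (x + y - 1) * betaDensity y) * betaDensity x =
      ∫ w, f w * betaDensity (w + 1 - x) * betaDensity x := by
    intro x
    rw [← integral_mul_const, ← integral_add_right_eq_self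
      (fun w => f w * betaDensity (w + 1 - x) * betaDensity x) (x - 1)]
    refine integral_congr_ae (Filter.Eventually.of_forall fun y => ?_)
    have e1 : y + (x - 1) = x + y - 1 := by ring
    have e2 : x + y - 1 + 1 - x = y := by ring
    simp only [e1, e2]
  simp only [h1]
  have hb := continuous_betaDensity
  rw [integral_integral_swap_of_hasCompactSupport]
  · have h2 : ∀ w : ℝ, ∫ x, f w * betaDensity (w + 1 - x) * betaDensity x =
        (fun w => f w * diagDensity w) |w| := by
      intro w
      simp only [mul_assoc, integral_const_mul]
      rcases abs_choice w with h | h <;> rw [h]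
      · rfl
      · rw [heven, diagDensity_neg]
        rfl
    simp only [h2]
    rw [integral_comp_abs (f := fun w => f w * diagDensity w)]
    congr 1
    rw [intervalIntegral.integral_of_le zero_le_one,
      setIntegral_eq_of_subset_of_forall_sdiff_eq_zero measurableSet_Ioi
        (Set.Ioc_subset_Ioi_self : Set.Ioc (0 : ℝ) 1 ⊆ Set.Ioi 0)]
    · refine setIntegral_congr_fun measurableSet_Ioc fun x hx => ?_
      simp only [diagDensity_of_mem hx.1.le hx.2]
    · intro x hx
      have : 1 < x := by
        by_contra h
        exact hx.2 ⟨hx.1, not_lt.1 h⟩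
      rw [diagDensity_of_one_le this, mul_zero]
  · exact ((hf.comp continuous_snd).mul (hb.comp (by fun_prop :
      Continuous fun p : ℝ × ℝ => p.2 + 1 - p.1))).mul (hb.comp continuous_fst)
  · refine HasCompactSupport.intro (K := Set.Icc (0 : ℝ) 1 ×ˢ Set.Icc (-1 : ℝ) 1)
      (isCompact_Icc.prod isCompact_Icc) ?_
    rintro ⟨x, w⟩ hxw
    simp only [Function.uncurry_apply_pair]
    by_cases hx : x ∈ Set.Icc (0 : ℝ) 1
    · have : w + 1 - x ∉ Set.Icc (0 : ℝ) 1 := fun h =>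
        hxw ⟨hx, by linarith [h.1, hx.1], by linarith [h.2, hx.2]⟩
      rw [betaDensity_of_notMem this, mul_zero, zero_mul]
    · rw [betaDensity_of_notMem hx, mul_zero]

/-! ### The Bloch length of a mixture of states of `ℰ_{2,2}` -/

open scoped ComplexOrder in
theorem posSemidef_mix {M N : Matrix (Fin 2) (Fin 2) ℂ} (hM : M.PosSemidef)
    (hN : N.PosSemidef) : (mix M N).PosSemidef :=
  (hM.add hN).smul (by norm_num [Complex.le_def] : (0 : ℂ) ≤ 1 / 2)

/-- The mixture of the reduced states of two pure states. -/
def mixState (p : PureTwoQubit × PureTwoQubit) : Matrix (Fin 2) (Fin 2) ℂ :=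
  mix (reducedState p.1.1) (reducedState p.2.1)

theorem continuous_mixState : Continuous mixState :=
  continuous_mix.comp (f := fun p : PureTwoQubit × PureTwoQubit =>
      (reducedState p.1.1, reducedState p.2.1))
    ((continuous_reducedState.comp continuous_fst).prodMk
      (continuous_reducedState.comp continuous_snd))

open scoped ComplexOrder in
theorem posSemidef_mixState (p : PureTwoQubit × PureTwoQubit) : (mixState p).PosSemidef :=
  posSemidef_mix (posSemidef_reducedState _) (posSemidef_reducedState _)

theorem isHermitian_mixState (p : PureTwoQubit × PureTwoQubit) : (mixState p).IsHermitian :=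
  isHermitian_mix (isHermitian_reducedState _) (isHermitian_reducedState _)

theorem trace_mixState (p : PureTwoQubit × PureTwoQubit) : (mixState p).trace = 1 :=
  trace_mix (trace_reducedState _) (trace_reducedState _)

theorem integral_comp_mixState {f : Matrix (Fin 2) (Fin 2) ℂ → ℝ} (hf : Continuous f) :
    ∫ p, f (mixState p) ∂(haarPureState 2 2).prod (haarPureState 2 2) =
      ∫ s : PureTwoQubit, ∫ t : PureTwoQubit, f (mix (reducedState s.1) (reducedState t.1))
        ∂haarPureState 2 2 ∂haarPureState 2 2 :=
  integral_prod _ (integrable_of_continuous_compactSpace (hf.comp continuous_mixState))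

/-- One `U` conjugates both states at once; invariance of each pure state is used separately. -/
theorem integral_comp_conjSU_mixState {f : Matrix (Fin 2) (Fin 2) ℂ → ℝ} (hf : Continuous f)
    (U : SU 2) :
    ∫ p, f (conjSU U (mixState p)) ∂(haarPureState 2 2).prod (haarPureState 2 2) =
      ∫ p, f (mixState p) ∂(haarPureState 2 2).prod (haarPureState 2 2) := by
  have hc : Continuous fun M => f (conjSU U M) :=
    hf.comp (continuous_conjSU.comp (f := fun M => (U, M)) (by fun_prop))
  rw [integral_comp_mixState hc, integral_comp_mixState hf]
  simp only [conjSU_mix, ← reducedState_actLeft]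
  rw [← integral_haarPureState_actLeft U fun ψ => ∫ t : PureTwoQubit,
    f (mix (reducedState ψ) (reducedState t.1)) ∂haarPureState 2 2]
  refine integral_congr_ae (Filter.Eventually.of_forall fun s => ?_)
  exact integral_haarPureState_actLeft U fun φ =>
    f (mix (reducedState (actLeft U s.1)) (reducedState φ))

theorem integral_mixState_eq_integral_conjSU {f : Matrix (Fin 2) (Fin 2) ℂ → ℝ}
    (hf : Continuous f) :
    ∫ p, f (mixState p) ∂(haarPureState 2 2).prod (haarPureState 2 2) =
      ∫ p, ∫ U, f (conjSU U (mixState p)) ∂haarSU 2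
        ∂(haarPureState 2 2).prod (haarPureState 2 2) := by
  rw [integral_integral_swap]
  · simp only [integral_comp_conjSU_mixState hf, integral_const, probReal_univ, one_smul]
  · exact integrable_of_continuous_compactSpace (hf.comp (continuous_conjSU.comp
      (f := fun p : (PureTwoQubit × PureTwoQubit) × SU 2 => (p.2, mixState p.1))
      (continuous_snd.prodMk (continuous_mixState.comp continuous_fst))))

theorem blochZ_mix (M N : Matrix (Fin 2) (Fin 2) ℂ) :
    blochZ (mix M N) = (M 0 0).re + (N 0 0).re - 1 := by
  simp [blochZ, mix]

theorem integral_blochRadius_pow_mixState (k : ℕ) :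
    ∫ p, (blochRadius (mixState p) ^ 2) ^ k ∂(haarPureState 2 2).prod (haarPureState 2 2) =
      (2 * k + 1) * (2 * ∫ z in (0 : ℝ)..1,
        z ^ (2 * k) * (6 / 5 * (1 - z ^ 5) + 6 * z ^ 3 - 6 * z ^ 2)) := by
  have hZ : Continuous fun M => blochZ M ^ (2 * k) := continuous_blochZ.pow _
  have h := integral_mixState_eq_integral_conjSU hZ
  rw [integral_comp_mixState hZ] at h
  simp only [integral_blochZ_pow_conjSU (isHermitian_mixState _) (trace_mixState _),
    integral_div, blochZ_mix] at h
  rw [integral_integral_reducedState_zero_zero (g := fun x y => (x + y - 1) ^ (2 * k))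
      (by unfold Function.uncurry; fun_prop),
    integral_integral_even_betaDensity (f := fun x => x ^ (2 * k)) (by fun_prop)
      (fun x => by rw [pow_mul, neg_sq, ← pow_mul]), eq_div_iff (by positivity)] at h
  simp only [← pow_mul]
  rw [← h, mul_comm]

/-- With `d` the polynomial on the right, `p2 r = -2 r d'(r)` and `d 1 = 0`, so this is an
integration by parts; it is checked by evaluating both sides. -/
theorem integral_pow_mul_p2 (k : ℕ) :
    ∫ r in (0 : ℝ)..1, (r ^ 2) ^ k * p2 r = (2 * k + 1) * (2 * ∫ z in (0 : ℝ)..1,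
        z ^ (2 * k) * (6 / 5 * (1 - z ^ 5) + 6 * z ^ 3 - 6 * z ^ 2)) := by
  have h1 : ∀ r : ℝ, (r ^ 2) ^ k * p2 r =
      12 * r ^ (2 * k + 5) - 36 * r ^ (2 * k + 3) + 24 * r ^ (2 * k + 2) := by
    intro r
    rw [p2]
    ring
  have h2 : ∀ z : ℝ, z ^ (2 * k) * (6 / 5 * (1 - z ^ 5) + 6 * z ^ 3 - 6 * z ^ 2) =
      6 / 5 * z ^ (2 * k) - 6 / 5 * z ^ (2 * k + 5) + 6 * z ^ (2 * k + 3) -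
        6 * z ^ (2 * k + 2) := by
    intro z
    ring
  have hi : ∀ (c : ℝ) (n : ℕ), IntervalIntegrable (fun x : ℝ => c * x ^ n) volume 0 1 :=
    fun c n => Continuous.intervalIntegrable (by fun_prop) _ _
  simp only [h1, h2]
  rw [intervalIntegral.integral_add ((hi _ _).sub (hi _ _)) (hi _ _),
    intervalIntegral.integral_sub (hi _ _) (hi _ _),
    intervalIntegral.integral_sub (((hi _ _).sub (hi _ _)).add (hi _ _)) (hi _ _),
    intervalIntegral.integral_add ((hi _ _).sub (hi _ _)) (hi _ _),
    intervalIntegral.integral_sub (hi _ _) (hi _ _)]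
  simp only [intervalIntegral.integral_const_mul, integral_pow]
  push_cast
  norm_num
  field_simp
  ring

theorem continuous_p2 : Continuous p2 := by
  unfold p2
  fun_prop

/-- The Bloch length of the mixture has density `p2`. -/
theorem integral_comp_blochRadius_mixState {φ : ℝ → ℝ} (hφ : Continuous φ) :
    ∫ p, φ (blochRadius (mixState p)) ∂(haarPureState 2 2).prod (haarPureState 2 2) =
      ∫ r in (0 : ℝ)..1, φ r * p2 r := by
  have h := integral_comp_eq_of_moments (μ := (haarPureState 2 2).prod (haarPureState 2 2))
    (X := fun p => blochRadius (mixState p) ^ 2) (Y := fun r => r ^ 2) (w := p2)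
    ((continuous_blochRadius.comp continuous_mixState).pow 2).measurable
    (fun s => sq_mem_Icc (blochRadius_mem_Icc (posSemidef_mixState s)))
    (by fun_prop) continuous_p2 (fun x hx => sq_mem_Icc hx) (fun k => by
      rw [integral_blochRadius_pow_mixState, integral_pow_mul_p2])
    (hφ.comp Real.continuous_sqrt)
  simp only [Function.comp_def, Real.sqrt_sq (blochRadius_nonneg _)] at h
  rw [h]
  refine intervalIntegral.integral_congr fun r hr => ?_
  rw [Set.uIcc_of_le zero_le_one] at hr
  simp only [Real.sqrt_sq hr.1]

theorem avgEntropy_ensemble : avgEntropy (ensemble 2 2) (ensemble 2 2) =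
    ∫ s : PureTwoQubit, ∫ t : PureTwoQubit,
      qubitEntropy (mix (reducedState s.1) (reducedState t.1))
        ∂haarPureState 2 2 ∂haarPureState 2 2 :=
  (integral_vonNeumannEntropy_map continuous_reducedState continuous_reducedState
    (fun s => ⟨isHermitian_reducedState s.1, trace_reducedState s⟩)
    (fun s => ⟨isHermitian_reducedState s.1, trace_reducedState s⟩)).2

theorem avgDiagEntropy_ensemble : avgDiagEntropy (ensemble 2 2) (ensemble 2 2) =
    ∫ s : PureTwoQubit, ∫ t : PureTwoQubit,
      H₂ (((reducedState s.1 0 0).re + (reducedState t.1 0 0).re) / 2)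
        ∂haarPureState 2 2 ∂haarPureState 2 2 :=
  (integral_vonNeumannEntropy_diagPart_map continuous_reducedState continuous_reducedState
    (fun s => ⟨isHermitian_reducedState s.1, trace_reducedState s⟩)
    (fun s => ⟨isHermitian_reducedState s.1, trace_reducedState s⟩)).2

theorem avgCoherence_ensemble : avgCoherence (ensemble 2 2) (ensemble 2 2) =
    avgDiagEntropy (ensemble 2 2) (ensemble 2 2) - avgEntropy (ensemble 2 2) (ensemble 2 2) :=
  avgCoherence_map continuous_reducedState continuous_reducedState
    (fun s => ⟨isHermitian_reducedState s.1, trace_reducedState s⟩)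
    (fun s => ⟨isHermitian_reducedState s.1, trace_reducedState s⟩)

theorem avgEntropy_ensemble_eq_integral_orbits :
    avgEntropy (ensemble 2 2) (ensemble 2 2) = ∫ r₁ in (0 : ℝ)..1, ∫ r₂ in (0 : ℝ)..1,
      avgEntropyOrbits r₁ r₂ * (3 * r₁ ^ 2) * (3 * r₂ ^ 2) := by
  rw [avgEntropy_ensemble, integral_integral_reducedState_eq
    (K := fun M N => qubitEntropy (mix M N)) (continuous_qubitEntropy.comp continuous_mix)]
  simp only [avgEntropyOrbits, avgEntropy_qubitOrbit]

theorem avgDiagEntropy_ensemble_eq_integral_orbits :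
    avgDiagEntropy (ensemble 2 2) (ensemble 2 2) = ∫ r₁ in (0 : ℝ)..1, ∫ r₂ in (0 : ℝ)..1,
      avgDiagEntropyOrbits ((1 - r₁) / 2) ((1 - r₂) / 2) * (3 * r₁ ^ 2) * (3 * r₂ ^ 2) := by
  rw [avgDiagEntropy_ensemble, integral_integral_reducedState_eq
    (K := fun M N => H₂ (((M 0 0).re + (N 0 0).re) / 2))
    (continuous_H₂.comp (((Complex.continuous_re.comp (continuous_fst.matrix_elem 0 0)).add
      (Complex.continuous_re.comp (continuous_snd.matrix_elem 0 0))).div_const _))]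
  simp only [avgDiagEntropyOrbits, avgDiagEntropy_qubitOrbit]

theorem avgEntropy_ensemble_eq_integral_p2 : avgEntropy (ensemble 2 2) (ensemble 2 2) =
    ∫ r in (0 : ℝ)..1, H₂ ((1 - r) / 2) * p2 r := by
  rw [avgEntropy_ensemble, ← integral_comp_mixState continuous_qubitEntropy]
  exact integral_comp_blochRadius_mixState (φ := fun r => H₂ ((1 - r) / 2))
    (continuous_H₂.comp (by fun_prop))

theorem avgDiagEntropy_ensemble_eq_integral : avgDiagEntropy (ensemble 2 2) (ensemble 2 2) =
    2 * ∫ z in (0 : ℝ)..1, H₂ ((1 - z) / 2) * (6 / 5 * (1 - z ^ 5) + 6 * z ^ 3 - 6 * z ^ 2) := by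
  have hc : Continuous fun z : ℝ => H₂ ((1 - z) / 2) := continuous_H₂.comp (by fun_prop)
  rw [avgDiagEntropy_ensemble, integral_integral_reducedState_zero_zero
    (g := fun x y => H₂ ((x + y) / 2)) (continuous_H₂.comp (by fun_prop)),
    ← integral_integral_even_betaDensity hc (fun x => by
      rw [← H₂_one_sub]
      congr 1
      ring)]
  have : ∀ x y : ℝ, H₂ ((1 - (x + y - 1)) / 2) = H₂ ((x + y) / 2) := by
    intro x y
    rw [← H₂_one_sub]
    congr 1
    ring
  simp only [this]

/-! ### Mixtures of two orbits -/

/-- Left invariance in `V` and conjugation invariance of `f` leave only the relative unitary, so the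
first may be taken to be 1. -/
theorem integral_comp_mix_orbitState {a b : ℝ} {f : Matrix (Fin 2) (Fin 2) ℂ → ℝ}
    (hf : ∀ U M, f (conjSU U M) = f M) :
    ∫ U, ∫ V, f (mix (orbitState a U) (orbitState b V)) ∂haarSU 2 ∂haarSU 2 =
      ∫ V, f (mix (orbitState a 1) (orbitState b V)) ∂haarSU 2 := by
  have : ∀ U : SU 2, ∫ V, f (mix (orbitState a U) (orbitState b V)) ∂haarSU 2 =
      ∫ V, f (mix (orbitState a 1) (orbitState b V)) ∂haarSU 2 := by
    intro U
    rw [← integral_mul_left_eq_self _ U]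
    refine integral_congr_ae (Filter.Eventually.of_forall fun V => ?_)
    have e : mix (orbitState a U) (orbitState b (U * V)) =
        conjSU U (mix (orbitState a 1) (orbitState b V)) := by
      rw [conjSU_mix, conjSU_orbitState, conjSU_orbitState, mul_one]
    simp only [e, hf]
  simp only [this, integral_const, probReal_univ, one_smul]

theorem det_orbitState (a : ℝ) (U : SU 2) : (orbitState a U).det = ((1 - a) * a : ℝ) := by
  have h : orbitState a U = conjSU U (diagonal (fun i => ((![1 - a, a] i : ℝ) : ℂ))) := rfl
  rw [h, det_conjSU, det_diagonal, Fin.prod_univ_two]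
  simp

/-- Law of cosines: the first Bloch vector lies on the third axis, and `2|V₀₀|² - 1` is the cosine
of the angle between the vectors when `r₁` and `r₂` are positive. -/
theorem blochRadius_mix_orbitState (r₁ r₂ : ℝ) (V : SU 2) :
    blochRadius (mix (orbitState ((1 - r₁) / 2) 1) (orbitState ((1 - r₂) / 2) V)) =
      √((r₁ ^ 2 + r₂ ^ 2 +
        2 * r₁ * r₂ * (2 * ‖(V : Matrix (Fin 2) (Fin 2) ℂ) 0 0‖ ^ 2 - 1)) / 4) := by
  set N := orbitState ((1 - r₂) / 2) V with hN
  have hd : N 0 0 * N 1 1 - N 0 1 * N 1 0 = ((1 - (1 - r₂) / 2) * ((1 - r₂) / 2) : ℝ) := by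
    rw [← det_fin_two, det_orbitState]
  have ht : N 0 0 + N 1 1 = 1 := by rw [← trace_fin_two, trace_orbitState]
  have h0 := orbitState_apply_zero_zero ((1 - r₂) / 2) V
  rw [← hN] at h0
  have hdet : (mix (orbitState ((1 - r₁) / 2) 1) N).det =
      (((1 - (r₁ ^ 2 + r₂ ^ 2 +
        2 * r₁ * r₂ * (2 * ‖(V : Matrix (Fin 2) (Fin 2) ℂ) 0 0‖ ^ 2 - 1)) / 4) / 4 : ℝ) : ℂ) := by
    have h1 : N 1 1 = 1 - N 0 0 := by linear_combination ht
    rw [h1] at hd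
    rw [det_fin_two, orbitState, diagonal_ofReal_pair]
    simp [mix]
    push_cast at hd h0
    rw [h1, h0]
    rw [h0] at hd
    linear_combination hd / 4
  rw [blochRadius, hdet, Complex.ofReal_re]
  congr 1
  ring

theorem avgEntropyOrbits_eq {r₁ r₂ : ℝ} (h₁ : 0 < r₁) (h₂ : 0 < r₂) :
    avgEntropyOrbits r₁ r₂ = ∫ r in (|r₁ - r₂| / 2)..((r₁ + r₂) / 2),
      H₂ ((1 - r) / 2) * p r r₁ r₂ := by
  set φ : ℝ → ℝ := fun x =>
    H₂ ((1 - √((r₁ ^ 2 + r₂ ^ 2 + 2 * r₁ * r₂ * (2 * x - 1)) / 4)) / 2) with hφdef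
  have hφ : Continuous φ := continuous_H₂.comp (by fun_prop)
  have hle : |r₁ - r₂| / 2 ≤ (r₁ + r₂) / 2 := by
    have : |r₁ - r₂| ≤ r₁ + r₂ := abs_le.2 ⟨by linarith, by linarith⟩
    linarith
  have hL : avgEntropyOrbits r₁ r₂ = ∫ x in (0 : ℝ)..1, φ x := by
    rw [avgEntropyOrbits, avgEntropy_qubitOrbit, integral_comp_mix_orbitState qubitEntropy_conjSU,
      ← integral_comp_normSq_haarSU hφ]
    simp only [qubitEntropy, blochRadius_mix_orbitState, hφdef]
  -- This `f` solves the law of cosines for the uniform variable in terms of the radius `r`; its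
  -- derivative is the density `p`.
  set f : ℝ → ℝ := fun r => (4 * r ^ 2 - (r₁ - r₂) ^ 2) / (4 * (r₁ * r₂)) with hf
  have hderiv : ∀ r ∈ Set.uIcc (|r₁ - r₂| / 2) ((r₁ + r₂) / 2),
      HasDerivAt f (2 * r / (r₁ * r₂)) r := by
    intro r _
    have := ((((hasDerivAt_id r).pow 2).const_mul 4).sub_const ((r₁ - r₂) ^ 2)).div_const
      (4 * (r₁ * r₂))
    refine this.congr_deriv ?_
    simp
    field_simp
  have hsub := intervalIntegral.integral_comp_mul_deriv hderiv (by fun_prop) hφ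
  have hf0 : f (|r₁ - r₂| / 2) = 0 := by
    simp only [hf, div_pow, sq_abs]
    ring
  have hf1 : f ((r₁ + r₂) / 2) = 1 := by
    simp only [hf]
    field_simp
    ring
  rw [hf0, hf1] at hsub
  rw [hL, ← hsub]
  refine intervalIntegral.integral_congr fun r hr => ?_
  rw [Set.uIcc_of_le hle] at hr
  have hr0 : 0 ≤ r := le_trans (by positivity) hr.1
  have h4 : (r₁ ^ 2 + r₂ ^ 2 + 2 * r₁ * r₂ * (2 * f r - 1)) / 4 = r ^ 2 := by
    simp only [hf]
    field_simp
    ring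
  simp only [Function.comp_apply, hφdef, h4, Real.sqrt_sq hr0, p]
  rw [if_pos ⟨hr.1, hr.2⟩]

/-- Integrating twice gives a second difference of a second antiderivative. `integral_mul_trapezoid`
produces the same shape, so identifying the density of a sum of two uniform variables amounts to
matching four corners. -/
theorem integral_integral_comp_affine {h : ℝ → ℝ} (hh : Continuous h) {α β : ℝ} (hα : α ≠ 0)
    (hβ : β ≠ 0) (c : ℝ) {F₁ F₂ : ℝ → ℝ} (h₁ : ∀ x, HasDerivAt F₁ (h x) x)
    (h₂ : ∀ x, HasDerivAt F₂ (F₁ x) x) :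
    ∫ x in (0 : ℝ)..1, ∫ y in (0 : ℝ)..1, h (c + α * x + β * y) =
      (F₂ (c + α + β) - F₂ (c + β) - F₂ (c + α) + F₂ c) / (α * β) := by
  have hF1 : Continuous F₁ := continuous_iff_continuousAt.2 fun x => (h₁ x).continuousAt
  have inner : ∀ x : ℝ, ∫ y in (0 : ℝ)..1, h (c + α * x + β * y) =
      β⁻¹ * (F₁ (c + β + α * x) - F₁ (c + α * x)) := by
    intro x
    rw [intervalIntegral.integral_comp_add_mul h hβ (c + α * x),
      intervalIntegral.integral_eq_sub_of_hasDerivAt (fun x _ => h₁ x) (hh.intervalIntegrable _ _),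
      smul_eq_mul]
    congr 3 <;> ring
  have outer : ∀ d : ℝ, ∫ x in (0 : ℝ)..1, F₁ (d + α * x) = α⁻¹ * (F₂ (d + α) - F₂ d) := by
    intro d
    rw [intervalIntegral.integral_comp_add_mul F₁ hα d,
      intervalIntegral.integral_eq_sub_of_hasDerivAt (fun x _ => h₂ x) (hF1.intervalIntegrable _ _),
      smul_eq_mul]
    congr 3 <;> ring
  simp only [inner]
  have hi : ∀ d, IntervalIntegrable (fun x => F₁ (d + α * x)) volume 0 1 := fun d =>
    Continuous.intervalIntegrable (hF1.comp (by fun_prop)) _ _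
  rw [intervalIntegral.integral_const_mul, intervalIntegral.integral_sub (hi _) (hi _), outer,
    outer]
  have : c + β + α = c + α + β := by ring
  rw [this]
  field_simp
  ring

/-- The trapezoid is the minimum of three affine functions, which makes it visibly continuous.
Integration by parts on each piece leaves only values of `F₂` at the corners. -/
theorem integral_mul_trapezoid {h : ℝ → ℝ} (hh : Continuous h) {F₁ F₂ : ℝ → ℝ}
    (h₁ : ∀ x, HasDerivAt F₁ (h x) x) (h₂ : ∀ x, HasDerivAt F₂ (F₁ x) x) {s t : ℝ}
    (hst : s ≤ t) (ht : t ≤ 1 - t) :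
    ∫ x in s..(1 - s), h x * min (min (x - s) (t - s)) (1 - s - x) =
      F₂ (1 - s) - F₂ (1 - t) - F₂ t + F₂ s := by
  have hi : ∀ a b, IntervalIntegrable (fun x => h x * min (min (x - s) (t - s)) (1 - s - x))
      volume a b := fun a b => Continuous.intervalIntegrable (hh.mul (by fun_prop)) a b
  rw [← intervalIntegral.integral_add_adjacent_intervals (hi s t) (hi t (1 - s)),
    ← intervalIntegral.integral_add_adjacent_intervals (hi t (1 - t)) (hi (1 - t) (1 - s))]
  have e1 : ∫ x in s..t, h x * min (min (x - s) (t - s)) (1 - s - x) =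
      ∫ x in s..t, h x * (x - s) := by
    refine intervalIntegral.integral_congr fun x hx => ?_
    rw [Set.uIcc_of_le hst] at hx
    rw [min_eq_left (by linarith [hx.2] : x - s ≤ t - s), min_eq_left (by linarith [hx.2])]
  have e2 : ∫ x in t..(1 - t), h x * min (min (x - s) (t - s)) (1 - s - x) =
      ∫ x in t..(1 - t), h x * (t - s) := by
    refine intervalIntegral.integral_congr fun x hx => ?_
    rw [Set.uIcc_of_le ht] at hx
    rw [min_eq_right (by linarith [hx.1] : t - s ≤ x - s), min_eq_left (by linarith [hx.2])]
  have e3 : ∫ x in (1 - t)..(1 - s), h x * min (min (x - s) (t - s)) (1 - s - x) =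
      ∫ x in (1 - t)..(1 - s), h x * (1 - s - x) := by
    refine intervalIntegral.integral_congr fun x hx => ?_
    rw [Set.uIcc_of_le (by linarith)] at hx
    rw [min_eq_right (by linarith [hx.1] : t - s ≤ x - s), min_eq_right (by linarith [hx.1])]
  have d1 : ∀ x, HasDerivAt (fun x => F₁ x * (x - s) - F₂ x) (h x * (x - s)) x := by
    intro x
    have := ((h₁ x).mul ((hasDerivAt_id x).sub_const s)).sub (h₂ x)
    exact this.congr_deriv (by simp)
  have d3 : ∀ x, HasDerivAt (fun x => F₁ x * (1 - s - x) + F₂ x) (h x * (1 - s - x)) x := by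
    intro x
    have := ((h₁ x).mul ((hasDerivAt_id x).const_sub (1 - s))).add (h₂ x)
    exact this.congr_deriv (by simp)
  rw [e1, e2, e3, intervalIntegral.integral_mul_const,
    intervalIntegral.integral_eq_sub_of_hasDerivAt (fun x _ => d1 x)
      (Continuous.intervalIntegrable (hh.mul (by fun_prop)) _ _),
    intervalIntegral.integral_eq_sub_of_hasDerivAt (fun x _ => h₁ x) (hh.intervalIntegrable _ _),
    intervalIntegral.integral_eq_sub_of_hasDerivAt (fun x _ => d3 x)
      (Continuous.intervalIntegrable (hh.mul (by fun_prop)) _ _)]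
  ring

theorem q_eq {a b x : ℝ} (ha : a ≤ 1 / 2) (hb : b ≤ 1 / 2)
    (h0 : t₀ a b ≤ x) (h1 : x ≤ 1 - t₀ a b) :
    q x a b = 1 / ((1 / 2 - a) * (1 / 2 - b)) *
      min (min (x - t₀ a b) (t₁ a b - t₀ a b)) (1 - t₀ a b - x) := by
  have ht : t₁ a b ≤ 1 - t₁ a b := by
    unfold t₁
    linarith [abs_nonneg (a - b)]
  have hst : t₀ a b ≤ t₁ a b := by
    unfold t₀ t₁
    rcases abs_cases (a - b) with h | h <;> linarith
  rw [q]
  congr 1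
  rw [if_neg (not_lt.2 h0)]
  split_ifs with h2 h3
  · rw [min_eq_left (by linarith : x - t₀ a b ≤ t₁ a b - t₀ a b), min_eq_left (by linarith)]
  · rw [min_eq_right (by linarith : t₁ a b - t₀ a b ≤ x - t₀ a b), min_eq_left (by linarith)]
  · rw [min_eq_right (by linarith : t₁ a b - t₀ a b ≤ x - t₀ a b), min_eq_right (by linarith)]
    ring

theorem avgDiagEntropyOrbits_eq {a b : ℝ} (ha : a < 1 / 2) (hb : b < 1 / 2) :
    avgDiagEntropyOrbits a b = ∫ x in (t₀ a b)..(1 - t₀ a b), H₂ x * q x a b := by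
  set F₁ : ℝ → ℝ := fun s => ∫ x in (0 : ℝ)..s, H₂ x with hF₁
  have h₁ : ∀ x, HasDerivAt F₁ (H₂ x) x := fun x => continuous_H₂.integral_hasStrictDerivAt 0 x
    |>.hasDerivAt
  have hc₁ : Continuous F₁ := continuous_iff_continuousAt.2 fun x => (h₁ x).continuousAt
  set F₂ : ℝ → ℝ := fun s => ∫ x in (0 : ℝ)..s, F₁ x with hF₂
  have h₂ : ∀ x, HasDerivAt F₂ (F₁ x) x := fun x => hc₁.integral_hasStrictDerivAt 0 x
    |>.hasDerivAt
  have hst : t₀ a b ≤ t₁ a b := by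
    unfold t₀ t₁
    rcases abs_cases (a - b) with h | h <;> linarith
  have ht : t₁ a b ≤ 1 - t₁ a b := by
    unfold t₁
    linarith [abs_nonneg (a - b)]
  have hα : 1 / 2 - a ≠ 0 := by linarith
  have hβ : 1 / 2 - b ≠ 0 := by linarith
  have hR : ∫ x in (t₀ a b)..(1 - t₀ a b), H₂ x * q x a b =
      1 / ((1 / 2 - a) * (1 / 2 - b)) *
        (F₂ (1 - t₀ a b) - F₂ (1 - t₁ a b) - F₂ (t₁ a b) + F₂ (t₀ a b)) := by
    rw [← integral_mul_trapezoid continuous_H₂ h₁ h₂ hst ht, ← intervalIntegral.integral_const_mul]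
    refine intervalIntegral.integral_congr fun x hx => ?_
    rw [Set.uIcc_of_le (by linarith)] at hx
    simp only [q_eq ha.le hb.le hx.1 hx.2]
    ring
  have hL : avgDiagEntropyOrbits a b = ∫ x in (0 : ℝ)..1, ∫ y in (0 : ℝ)..1,
      H₂ ((a + b) / 2 + (1 / 2 - a) * x + (1 / 2 - b) * y) := by
    have hcont : ∀ x : ℝ, Continuous fun y : ℝ =>
        H₂ ((a + b) / 2 + (1 / 2 - a) * x + (1 / 2 - b) * y) :=
      fun x => continuous_H₂.comp (by fun_prop)
    rw [← integral_comp_normSq_haarSU (φ := fun x => ∫ y in (0 : ℝ)..1,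
      H₂ ((a + b) / 2 + (1 / 2 - a) * x + (1 / 2 - b) * y))
      (intervalIntegral.continuous_parametric_intervalIntegral_of_continuous'
        (f := fun x y => H₂ ((a + b) / 2 + (1 / 2 - a) * x + (1 / 2 - b) * y))
        (continuous_H₂.comp (by fun_prop : Continuous fun p : ℝ × ℝ =>
          (a + b) / 2 + (1 / 2 - a) * p.1 + (1 / 2 - b) * p.2)) 0 1)]
    simp only [← integral_comp_normSq_haarSU (hcont _)]
    rw [avgDiagEntropyOrbits, avgDiagEntropy_qubitOrbit]
    simp only [orbitState_apply_zero_zero, Complex.ofReal_re]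
    congr! 5
    ring
  rw [hL, hR, integral_integral_comp_affine continuous_H₂ hα hβ _ h₁ h₂]
  have e0 : (a + b) / 2 + (1 / 2 - a) + (1 / 2 - b) = 1 - t₀ a b := by unfold t₀; ring
  rw [e0, div_eq_inv_mul, ← one_div]
  congr 1
  -- The sign of `a - b` decides which of the two middle corners is `t₁` and which is `1 - t₁`.
  rcases abs_cases (a - b) with h | h
  · have e1 : (a + b) / 2 + (1 / 2 - b) = 1 - t₁ a b := by unfold t₁; rw [h.1]; ring
    have e2 : (a + b) / 2 + (1 / 2 - a) = t₁ a b := by unfold t₁; rw [h.1]; ring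
    rw [e1, e2, t₀]
  · have e1 : (a + b) / 2 + (1 / 2 - b) = t₁ a b := by unfold t₁; rw [h.1]; ring
    have e2 : (a + b) / 2 + (1 / 2 - a) = 1 - t₁ a b := by unfold t₁; rw [h.1]; ring
    rw [e1, e2, t₀]
    ring

/-! ### Closed forms -/

theorem H₂_half_one_sub {z : ℝ} (h0 : 0 ≤ z) (h1 : z ≤ 1) : H₂ ((1 - z) / 2) =
    1 - ((1 - z) * Real.log (1 - z) + (1 + z) * Real.log (1 + z)) / (2 * Real.log 2) := by
  have hl : Real.log 2 ≠ 0 := (Real.log_pos one_lt_two).ne'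
  have e : 1 - (1 - z) / 2 = (1 + z) / 2 := by ring
  rw [H₂, e, Real.logb, Real.logb, Real.log_div (by linarith : 1 + z ≠ 0) two_ne_zero]
  rcases h1.eq_or_lt with rfl | h
  · norm_num
  · rw [Real.log_div (by linarith : 1 - z ≠ 0) two_ne_zero]
    field_simp
    ring

open Polynomial in
/-- Integration of a polynomial against `(1 - z) log (1 - z) + (1 + z) log (1 + z)` on `[0, 1]`,
from polynomial antiderivatives. -/
theorem integral_mul_log_add_mul_log {w : ℝ → ℝ} (hw : Continuous w) (P Q R : ℝ[X])
    (hP : ∀ z, P.derivative.eval z * (1 - z) - P.eval z = w z * (1 - z))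
    (hQ : ∀ z, Q.derivative.eval z * (1 + z) + Q.eval z = w z * (1 + z))
    (hR : ∀ z, R.derivative.eval z = P.eval z - Q.eval z) :
    ∫ z in (0 : ℝ)..1, ((1 - z) * Real.log (1 - z) + (1 + z) * Real.log (1 + z)) * w z =
      2 * Q.eval 1 * Real.log 2 + R.eval 1 - R.eval 0 := by
  have hlog : Continuous fun z : ℝ => (1 - z) * Real.log (1 - z) :=
    Real.continuous_mul_log.comp (by fun_prop : Continuous fun z : ℝ => 1 - z)
  have hlog' : Continuous fun z : ℝ => (1 + z) * Real.log (1 + z) :=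
    Real.continuous_mul_log.comp (by fun_prop : Continuous fun z : ℝ => 1 + z)
  -- The first two hypotheses read `((1 - z) P)' = w (1 - z)` and `((1 + z) Q)' = w (1 + z)`; the
  -- third cancels the rational remainder. Since `x log x` is continuous at 0, the antiderivative is
  -- continuous up to `z = 1` and its `P` term vanishes there.
  rw [intervalIntegral.integral_eq_sub_of_hasDerivAt_of_le zero_le_one
    (f := fun z => P.eval z * ((1 - z) * Real.log (1 - z)) +
      Q.eval z * ((1 + z) * Real.log (1 + z)) + R.eval z)]
  · norm_num
    ring
  · exact (((P.continuous.mul hlog).add (Q.continuous.mul hlog')).add R.continuous).continuousOn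
  · intro z hz
    have h1 : 1 - z ≠ 0 := by linarith [hz.2]
    have h2 : 1 + z ≠ 0 := by linarith [hz.1]
    have d1 : HasDerivAt (fun z : ℝ => 1 - z) (-1) z := by
      simpa using (hasDerivAt_id z).const_sub 1
    have d2 : HasDerivAt (fun z : ℝ => 1 + z) 1 z := by
      simpa using (hasDerivAt_id z).const_add 1
    have := (((P.hasDerivAt z).mul (d1.mul (d1.log h1))).add
      ((Q.hasDerivAt z).mul (d2.mul (d2.log h2)))).add (R.hasDerivAt z)
    refine this.congr_deriv ?_
    simp only [Pi.mul_apply]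
    rw [hR]
    field_simp
    linear_combination Real.log (1 - z) * hP z + Real.log (1 + z) * hQ z
  · exact ((hlog.add hlog').mul hw).intervalIntegrable _ _

theorem integral_H₂_mul {w : ℝ → ℝ} (hw : Continuous w) :
    ∫ z in (0 : ℝ)..1, H₂ ((1 - z) / 2) * w z = (∫ z in (0 : ℝ)..1, w z) -
      (∫ z in (0 : ℝ)..1, ((1 - z) * Real.log (1 - z) + (1 + z) * Real.log (1 + z)) * w z) /
        (2 * Real.log 2) := by
  have hlog : Continuous fun z : ℝ => (1 - z) * Real.log (1 - z) :=
    Real.continuous_mul_log.comp (by fun_prop : Continuous fun z : ℝ => 1 - z)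
  have hlog' : Continuous fun z : ℝ => (1 + z) * Real.log (1 + z) :=
    Real.continuous_mul_log.comp (by fun_prop : Continuous fun z : ℝ => 1 + z)
  have hi : IntervalIntegrable (fun z => ((1 - z) * Real.log (1 - z) +
      (1 + z) * Real.log (1 + z)) * w z / (2 * Real.log 2)) volume 0 1 :=
    (((hlog.add hlog').mul hw).div_const _).intervalIntegrable _ _
  rw [← intervalIntegral.integral_div, ← intervalIntegral.integral_sub
    (hw.intervalIntegrable _ _) hi]
  refine intervalIntegral.integral_congr fun z hz => ?_
  rw [Set.uIcc_of_le zero_le_one] at hz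
  simp only [H₂_half_one_sub hz.1 hz.2]
  ring

open Polynomial in
theorem integral_H₂_mul_p2 : ∫ r in (0 : ℝ)..1, H₂ ((1 - r) / 2) * p2 r =
    221 / (140 * Real.log 2) - 53 / 35 := by
  have hl : Real.log 2 ≠ 0 := (Real.log_pos one_lt_two).ne'
  have h1 : ∫ r in (0 : ℝ)..1, p2 r = 1 := by
    have e : ∀ r, p2 r = 12 * r ^ 5 - 36 * r ^ 3 + 24 * r ^ 2 := by
      intro r
      rw [p2]
      ring
    have hi : ∀ (c : ℝ) (n : ℕ), IntervalIntegrable (fun x : ℝ => c * x ^ n) volume 0 1 :=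
      fun c n => Continuous.intervalIntegrable (by fun_prop) _ _
    simp only [e]
    rw [intervalIntegral.integral_add ((hi _ _).sub (hi _ _)) (hi _ _),
      intervalIntegral.integral_sub (hi _ _) (hi _ _)]
    simp only [intervalIntegral.integral_const_mul, integral_pow]
    norm_num
  -- `(1 - z) P` is the antiderivative of `p2 z * (1 - z)` vanishing at 1, `(1 + z) Q` that of `p2 z
  -- * (1 + z)` vanishing at -1, and `R` that of `P - Q` vanishing at 0.
  rw [integral_H₂_mul continuous_p2, h1, integral_mul_log_add_mul_log continuous_p2
    (C (-17 / 35) + C (-17 / 35) * X + C (-17 / 35) * X ^ 2 + C (263 / 35) * X ^ 3 +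
      C (-262 / 35) * X ^ 4 + C (-2 / 7) * X ^ 5 + C (12 / 7) * X ^ 6)
    (C (123 / 35) + C (-123 / 35) * X + C (123 / 35) * X ^ 2 + C (157 / 35) * X ^ 3 +
      C (-262 / 35) * X ^ 4 + C (2 / 7) * X ^ 5 + C (12 / 7) * X ^ 6)
    (C (-4) * X + C (53 / 35) * X ^ 2 + C (-4 / 3) * X ^ 3 + C (53 / 70) * X ^ 4 +
      C (-2 / 21) * X ^ 6)]
  · simp only [eval_add, eval_mul, eval_C, eval_X, eval_pow]
    field_simp
    ring
  all_goals
    intro z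
    simp only [derivative_add, derivative_C, derivative_C_mul, derivative_X, derivative_X_pow,
      eval_add, eval_mul, eval_C, eval_X, eval_pow, eval_zero, eval_one, p2]
    norm_num
    ring

open Polynomial in
theorem integral_H₂_mul_diagDensity : 2 * ∫ z in (0 : ℝ)..1,
    H₂ ((1 - z) / 2) * (6 / 5 * (1 - z ^ 5) + 6 * z ^ 3 - 6 * z ^ 2) =
      37 / (140 * Real.log 2) + 19 / 35 := by
  have hl : Real.log 2 ≠ 0 := (Real.log_pos one_lt_two).ne'
  have hc : Continuous fun z : ℝ => 6 / 5 * (1 - z ^ 5) + 6 * z ^ 3 - 6 * z ^ 2 := by fun_prop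
  -- Half the mass, because this is one side of an even probability density on `[-1, 1]`.
  have h1 : ∫ z in (0 : ℝ)..1, (6 / 5 * (1 - z ^ 5) + 6 * z ^ 3 - 6 * z ^ 2) = 1 / 2 := by
    have e : ∀ z : ℝ, 6 / 5 * (1 - z ^ 5) + 6 * z ^ 3 - 6 * z ^ 2 =
        6 / 5 * z ^ 0 - 6 / 5 * z ^ 5 + 6 * z ^ 3 - 6 * z ^ 2 := by
      intro z
      ring
    have hi : ∀ (c : ℝ) (n : ℕ), IntervalIntegrable (fun x : ℝ => c * x ^ n) volume 0 1 :=
      fun c n => Continuous.intervalIntegrable (by fun_prop) _ _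
    simp only [e]
    rw [intervalIntegral.integral_sub (((hi _ _).sub (hi _ _)).add (hi _ _)) (hi _ _),
      intervalIntegral.integral_add ((hi _ _).sub (hi _ _)) (hi _ _),
      intervalIntegral.integral_sub (hi _ _) (hi _ _)]
    simp only [intervalIntegral.integral_const_mul, integral_pow]
    norm_num
  rw [integral_H₂_mul hc, h1, integral_mul_log_add_mul_log hc
    (C (-13 / 35) + C (29 / 35) * X + C (8 / 35) * X ^ 2 + C (-62 / 35) * X ^ 3 +
      C (43 / 35) * X ^ 4 + C (1 / 35) * X ^ 5 + C (-6 / 35) * X ^ 6)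
    (C (-6 / 35) + C (48 / 35) * X + C (-27 / 35) * X ^ 2 + C (-43 / 35) * X ^ 3 +
      C (43 / 35) * X ^ 4 + C (-1 / 35) * X ^ 5 + C (-6 / 35) * X ^ 6)
    (C (-1 / 5) * X + C (-19 / 70) * X ^ 2 + C (1 / 3) * X ^ 3 + C (-19 / 140) * X ^ 4 +
      C (1 / 105) * X ^ 6)]
  · simp only [eval_add, eval_mul, eval_C, eval_X, eval_pow]
    field_simp
    ring
  all_goals
    intro z
    simp only [derivative_add, derivative_C, derivative_C_mul, derivative_X, derivative_X_pow,
      eval_add, eval_mul, eval_C, eval_X, eval_pow, eval_zero, eval_one]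
    norm_num
    ring

theorem avgEntropy_ensemble_eq : avgEntropy (ensemble 2 2) (ensemble 2 2) =
    221 / (140 * Real.log 2) - 53 / 35 := by
  rw [avgEntropy_ensemble_eq_integral_p2, integral_H₂_mul_p2]

theorem avgDiagEntropy_ensemble_eq : avgDiagEntropy (ensemble 2 2) (ensemble 2 2) =
    37 / (140 * Real.log 2) + 19 / 35 := by
  rw [avgDiagEntropy_ensemble_eq_integral, integral_H₂_mul_diagDensity]

/-- The tightest use is 0.763111: its true error is about 4.6e-7 out of the allowed 5e-7, so `1 /
log 2` is needed to within a few 1e-8. -/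
theorem inv_log_two_bounds : 1.44269504 < (Real.log 2)⁻¹ ∧ (Real.log 2)⁻¹ < 1.442695042 := by
  have h1 := Real.log_two_gt_d9
  have h2 := Real.log_two_lt_d9
  have h0 : 0 < Real.log 2 := Real.log_pos one_lt_two
  constructor
  · rw [lt_inv_comm₀ (by norm_num) h0]
    refine h2.trans ?_
    norm_num
  · rw [inv_lt_comm₀ h0 (by norm_num)]
    refine lt_trans ?_ h1
    norm_num

end QubitMixture

end

theorem mainTheorem10 :
    -- average entropy of the mixture, for fixed spectra
    (∀ r₁ ∈ Set.Ioo (0 : ℝ) 1, ∀ r₂ ∈ Set.Ioo (0 : ℝ) 1,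
      QubitMixture.avgEntropyOrbits r₁ r₂ =
        ∫ r in (|r₁ - r₂| / 2)..((r₁ + r₂) / 2),
          QubitMixture.H₂ ((1 - r) / 2) * QubitMixture.p r r₁ r₂) ∧
    -- average entropy of the mixture, for independent states of the ensemble
    (QubitMixture.avgEntropy (QubitMixture.ensemble 2 2) (QubitMixture.ensemble 2 2) =
      ∫ r₁ in (0 : ℝ)..1, ∫ r₂ in (0 : ℝ)..1,
        QubitMixture.avgEntropyOrbits r₁ r₂ * (3 * r₁ ^ 2) * (3 * r₂ ^ 2)) ∧
    (QubitMixture.avgEntropy (QubitMixture.ensemble 2 2) (QubitMixture.ensemble 2 2) =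
      ∫ r in (0 : ℝ)..1, QubitMixture.H₂ ((1 - r) / 2) * QubitMixture.p2 r) ∧
    (QubitMixture.avgEntropy (QubitMixture.ensemble 2 2) (QubitMixture.ensemble 2 2) =
      221 / (140 * Real.log 2) - 53 / 35) ∧
    |QubitMixture.avgEntropy (QubitMixture.ensemble 2 2) (QubitMixture.ensemble 2 2)
      - 0.763111| ≤ 5e-7 ∧
    -- average entropy of the diagonal part, for fixed spectra
    (∀ a ∈ Set.Ioo (0 : ℝ) (1 / 2), ∀ b ∈ Set.Ioo (0 : ℝ) (1 / 2),
      QubitMixture.avgDiagEntropyOrbits a b =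
        ∫ x in (QubitMixture.t₀ a b)..(1 - QubitMixture.t₀ a b),
          QubitMixture.H₂ x * QubitMixture.q x a b) ∧
    -- average entropy of the diagonal part, for independent states of the ensemble
    (QubitMixture.avgDiagEntropy (QubitMixture.ensemble 2 2) (QubitMixture.ensemble 2 2) =
      ∫ r₁ in (0 : ℝ)..1, ∫ r₂ in (0 : ℝ)..1,
        QubitMixture.avgDiagEntropyOrbits ((1 - r₁) / 2) ((1 - r₂) / 2)
          * (3 * r₁ ^ 2) * (3 * r₂ ^ 2)) ∧
    |QubitMixture.avgDiagEntropy (QubitMixture.ensemble 2 2) (QubitMixture.ensemble 2 2)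
      - 0.92414| ≤ 5e-6 ∧
    -- average relative entropy of coherence
    (QubitMixture.avgCoherence (QubitMixture.ensemble 2 2) (QubitMixture.ensemble 2 2) =
      QubitMixture.avgDiagEntropy (QubitMixture.ensemble 2 2) (QubitMixture.ensemble 2 2)
        - QubitMixture.avgEntropy (QubitMixture.ensemble 2 2) (QubitMixture.ensemble 2 2)) ∧
    |QubitMixture.avgCoherence (QubitMixture.ensemble 2 2) (QubitMixture.ensemble 2 2)
      - 0.16103| ≤ 5e-6 := by
  obtain ⟨hlo, hhi⟩ := QubitMixture.inv_log_two_bounds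
  have e1 : 221 / (140 * Real.log 2) = 221 / 140 * (Real.log 2)⁻¹ := by ring
  have e2 : 37 / (140 * Real.log 2) = 37 / 140 * (Real.log 2)⁻¹ := by ring
  refine ⟨fun r₁ h₁ r₂ h₂ => QubitMixture.avgEntropyOrbits_eq h₁.1 h₂.1,
    QubitMixture.avgEntropy_ensemble_eq_integral_orbits,
    QubitMixture.avgEntropy_ensemble_eq_integral_p2, QubitMixture.avgEntropy_ensemble_eq, ?_,
    fun a ha b hb => QubitMixture.avgDiagEntropyOrbits_eq ha.2 hb.2,
    QubitMixture.avgDiagEntropy_ensemble_eq_integral_orbits, ?_,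
    QubitMixture.avgCoherence_ensemble, ?_⟩
  · rw [QubitMixture.avgEntropy_ensemble_eq, e1, abs_le]
    constructor <;> linarith
  · rw [QubitMixture.avgDiagEntropy_ensemble_eq, e2, abs_le]
    constructor <;> linarith
  · rw [QubitMixture.avgCoherence_ensemble, QubitMixture.avgDiagEntropy_ensemble_eq,
      QubitMixture.avgEntropy_ensemble_eq, e1, e2, abs_le]
    constructor <;> linarith
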